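/- Let $k\ge 2$ and $n\ge 1$. Consider formal operators $\Delta_k$ (a $k$-ary coproduct, with $1$ input and $k$ outputs) and $\mu_k$ (a $k$-ary product, with $k$ inputs and $1$ output). A finite composition of tensor products of copies of $\Delta_k$, $\mu_k$ and the identity is drawn as an upward directed planted plane graph, with one node for each use of $\Delta_k$ or $\mu_k$ and with the incoming and the outgoing edges of every node ordered from left to right. Two compositions are identified if their graphs are equivalent as upward planted plane graphs, i.e. isomorphic by a map that respects all these orders. A closed $k$-ary product-coproduct prograph is an equivalence class of compositions with a single input strand and a single output strand; let $\mathcal{PC}^k(n)$ be the set of those with exactly $n$ products and $n$ coproducts. A child of a node is one of its outgoing edges. Let $\mathbb{S}(n^3,\rho)$, $\rho=(1,k-1,1)$, be the set of standard set-valued Young tableaux of shape $n^3$ (three rows of $n$ cells) and row-constant density $\rho$: the functions from $\{1,\dots,(k+1)n\}$ to the cells such that every cell of row $i$ receives exactly $\rho_i$ integers, and every integer in a cell is smaller than every integer in the cell immediately to its right and in the cell immediately below it. For $G\in\mathcal{PC}^k(n)$, the generalized depth-left first search labels the edges of $G$ with $0,1,\dots,(k+1)n$ as follows. The initial edge gets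 the label $0$. When $0,\dots,i$ have been used, with $0\le i<(k+1)n$, call a node active if all its inputs are labelled and at least one of its outputs is not; take the highest labelled edge that ends in an active node $v$, and give the label $i+1$ to the leftmost unlabelled output of $v$. **Theorem.** 1. For every $G\in\mathcal{PC}^k(n)$ this procedure is well defined and labels each edge of $G$ exactly once. 2. Let $\Phi(G)$ be the filling of the diagram $n^3$ in which the labels of leftmost coproduct children are placed in the top row, the labels of all other coproduct children in the middle row, and the labels of product children in the bottom row, each row being filled in increasing order from left to right with $1$, $k-1$ and $1$ labels per cell, respectively (the label $0$ is ignored). Then $\Phi$ is a well-defined bijection $\mathcal{PC}^k(n)\to\mathbb{S}(n^3,\rho)$. 3. In particular $|\mathcal{PC}^k(n)|=|\mathbb{S}(n^3,\rho)|$. 4. For $k=2$ this number is the three-dimensional Catalan number: $|\mathcal{PC}^2(n)|=\dfrac{2\,(3n)!}{n!\,(n+1)!\,(n+2)!}$. -/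

import Mathlib

/-! ### Standard set-valued Young tableaux -/

/-- A standard set-valued Young tableau of shape `μ` and row-constant density `ρ`: a function from
`{1, …, M}`, where `M` is the sum of the densities of all cells, to the cells of `μ`, such that
every cell in row `i` receives exactly `ρ i` integers, and such that every integer in a cell is
smaller than every integer in the cell to its right and in the cell below it.
Cells are pairs (row, column), both counted from `0`, as in `YoungDiagram`. -/
@[ext]
structure SetValuedSYT (μ : YoungDiagram) (ρ : ℕ → ℕ) where
  /-- the cell that contains a given integer -/
  cell : Finset.Icc 1 (∑ c ∈ μ.cells, ρ c.1) → ℕ × ℕ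
  mem_shape : ∀ a, cell a ∈ μ
  density : ∀ c ∈ μ, {a | cell a = c}.ncard = ρ c.1
  row_standard : ∀ a b i j, cell a = (i, j) → cell b = (i, j + 1) → a < b
  column_standard : ∀ a b i j, cell a = (i, j) → cell b = (i + 1, j) → a < b

/-- The rectangular Young diagram `n^m`, with `m` rows of length `n`. -/
def rectDiagram (m n : ℕ) : YoungDiagram where
  cells := Finset.range m ×ˢ Finset.range n
  isLowerSet := by
    intro a b hba ha
    simp only [Finset.coe_product, Finset.coe_range, Set.mem_prod, Set.mem_Iio] at ha ⊢
    exact ⟨lt_of_le_of_lt hba.1 ha.1, lt_of_le_of_lt hba.2 ha.2⟩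

/-- The density `(1, k - 1, 1)` (rows counted from `0`; further rows are not used). -/
def density₃ (k : ℕ) : ℕ → ℕ
  | 0 => 1
  | 1 => k - 1
  | 2 => 1
  | _ => 0

namespace Prograph

/-! ### Compositions of `k`-ary products and coproducts -/

/-- The operators from which compositions are built: the identity `A → A`, the `k`-ary coproduct
`A → A ⊗ ⋯ ⊗ A`, and the `k`-ary product `A ⊗ ⋯ ⊗ A → A`. -/
inductive Op
  | id
  | coprod
  | prod
  deriving DecidableEq

/-- The number of inputs of an operator. -/
def Op.arity (k : ℕ) : Op → ℕ
  | .id => 1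
  | .coprod => 1
  | .prod => k

/-- The number of outputs of an operator. -/
def Op.coarity (k : ℕ) : Op → ℕ
  | .id => 1
  | .coprod => k
  | .prod => 1

/-- A formal composition. It is a list of stages, the first stage being applied first (so it is at
the bottom of the picture), and each stage is a tensor product of operators, listed from left to
right. For example `(Δ ⊗ id ⊗ Δ) ∘ Δ` is `[[Δ], [Δ, id, Δ]]`. -/
abbrev Composition := List (List Op)

/-- `IsComposable k a w b`: consecutive stages of `w` fit together, and `w` is a composition with
`a` inputs and `b` outputs. -/
def IsComposable (k : ℕ) : ℕ → Composition → ℕ → Prop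
  | a, [], b => a = b
  | a, s :: w, b =>
      (s.map (Op.arity k)).sum = a ∧ IsComposable k (s.map (Op.coarity k)).sum w b

/-- The compositions with one input and one output in which the `k`-ary coproduct and the `k`-ary
product are each used exactly `n` times. -/
def ClosedComposition (k n : ℕ) : Type :=
  {w : Composition // IsComposable k 1 w 1 ∧
    w.flatten.count Op.coprod = n ∧ w.flatten.count Op.prod = n}

/-! ### The plane graph of a composition -/

/-- A product or coproduct node of a directed plane graph, with its incoming edges and its outgoing
edges, both listed from left to right. -/
structure Node where
  op : Op
  ins : List ℕ
  outs : List ℕ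

/-- The action of a renaming of the edges on a node. -/
def Node.map (σ : ℕ → ℕ) (v : Node) : Node :=
  ⟨v.op, v.ins.map σ, v.outs.map σ⟩

/-- The combinatorial data of an upward planted plane graph: the edges are `0, …, numEdges - 1`,
and every node carries the left-to-right order of its incoming and of its outgoing edges.
`inputs` are the edges that leave the initial nodes and `outputs` are the edges that enter the
terminal nodes, again from left to right. -/
structure PlaneGraph where
  numEdges : ℕ
  nodes : List Node
  inputs : List ℕ
  outputs : List ℕ

/-- Draw one stage on top of the strands `xs` (from left to right), the numbers `≥ f` being free as
names of new edges. An identity continues its strand, any other operator becomes a node which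
absorbs its input strands and emits new edges. Returns the new nodes, the strands after the stage,
and the next free name. -/
def drawStage (k : ℕ) : List Op → List ℕ → ℕ → List Node × List ℕ × ℕ
  | [], _, f => ([], [], f)
  | .id :: s, xs, f =>
      let r := drawStage k s (xs.drop 1) f
      (r.1, xs.take 1 ++ r.2.1, r.2.2)
  | .coprod :: s, xs, f =>
      let r := drawStage k s (xs.drop 1) (f + k)
      (⟨.coprod, xs.take 1, List.range' f k⟩ :: r.1, List.range' f k ++ r.2.1, r.2.2)
  | .prod :: s, xs, f =>
      let r := drawStage k s (xs.drop k) (f + 1)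
      (⟨.prod, xs.take k, [f]⟩ :: r.1, [f] ++ r.2.1, r.2.2)

/-- Draw all stages of a composition, from bottom to top. -/
def draw (k : ℕ) : Composition → List ℕ → ℕ → List Node × List ℕ × ℕ
  | [], xs, f => ([], xs, f)
  | s :: w, xs, f =>
      let r := drawStage k s xs f
      let r' := draw k w r.2.1 r.2.2
      (r.1 ++ r'.1, r'.2)

/-- The plane graph of a composition `w` with `a` inputs. -/
def toGraph (k a : ℕ) (w : Composition) : PlaneGraph :=
  let r := draw k w (List.range a) a
  ⟨r.2.2, r.1, List.range a, r.2.1⟩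

/-- Equivalence of upward planted plane graphs: a bijection between the edges which carries nodes
to nodes of the same kind and respects the left-to-right orders of the incoming and outgoing edges
at every node and of the inputs and outputs of the graph. For connected upward plane graphs, this
ordered incidence data determines the planar embedding up to upward planar deformation. -/
def PlaneGraph.Equivalent (G H : PlaneGraph) : Prop :=
  ∃ σ : Equiv.Perm ℕ, (∀ e, σ e < H.numEdges ↔ e < G.numEdges) ∧
    (G.nodes.map (Node.map σ)).Perm H.nodes ∧
    G.inputs.map σ = H.inputs ∧ G.outputs.map σ = H.outputs

/-- The plane graph of a closed composition. -/
def ClosedComposition.graph {k n : ℕ} (w : ClosedComposition k n) : PlaneGraph :=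
  toGraph k 1 w.1

theorem Node.map_map (σ τ : ℕ → ℕ) (v : Node) : (v.map σ).map τ = v.map (τ ∘ σ) := by
  simp [Node.map]

theorem Node.map_id (v : Node) : v.map id = v := by
  simp [Node.map]

theorem PlaneGraph.equivalence : Equivalence PlaneGraph.Equivalent where
  refl G := ⟨1, by simp, by
    have h : (Node.map (1 : Equiv.Perm ℕ)) = id := by
      funext v; exact Node.map_id v
    rw [h, List.map_id], by simp, by simp⟩
  symm := by
    rintro G H ⟨σ, h₁, h₂, h₃, h₄⟩
    refine ⟨σ.symm, fun e => ?_, ?_, ?_, ?_⟩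
    · simpa using (h₁ (σ.symm e)).symm
    · have h := (h₂.map (Node.map σ.symm)).symm
      have hid : Node.map σ.symm ∘ Node.map σ = id := by
        funext v
        simp [Node.map_map, Node.map_id]
      simpa [hid] using h
    · simp [← h₃]
    · simp [← h₄]
  trans := by
    rintro G H K ⟨σ, h₁, h₂, h₃, h₄⟩ ⟨τ, g₁, g₂, g₃, g₄⟩
    refine ⟨σ.trans τ, fun e => ?_, ?_, ?_, ?_⟩
    · simpa using (g₁ (σ e)).trans (h₁ e)
    · have h := (h₂.map (Node.map τ)).trans g₂
      have hc : Node.map τ ∘ Node.map σ = Node.map (σ.trans τ) := by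
        funext v
        simp [Node.map_map]
      simpa [hc] using h
    · simp [← g₃, ← h₃]
    · simp [← g₄, ← h₄]

/-- Two compositions are identified if their plane graphs are equivalent. -/
instance closedSetoid (k n : ℕ) : Setoid (ClosedComposition k n) where
  r w w' := w.graph.Equivalent w'.graph
  iseqv :=
    ⟨fun w => PlaneGraph.equivalence.refl w.graph, PlaneGraph.equivalence.symm,
      PlaneGraph.equivalence.trans⟩

/-- The closed `k`-ary product-coproduct prographs with `n` products and `n` coproducts. -/
def ClosedPrograph (k n : ℕ) : Type := Quotient (closedSetoid k n)

/-! ### The generalized depth-left first search -/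

/-- The nodes `v` all of whose inputs have labels in `{0, …, i}` and which have an output whose
label is not in `{0, …, i}`. -/
def PlaneGraph.IsActive (G : PlaneGraph) (ℓ : ℕ → ℕ) (i : ℕ) (v : Node) : Prop :=
  v ∈ G.nodes ∧ (∀ e ∈ v.ins, ℓ e ≤ i) ∧ ∃ e ∈ v.outs, i < ℓ e

/-- `ℓ` is the labelling of the edges of `G` by `0, 1, 2, …` that is produced by the generalized
depth-left first search. The initial edge is labelled `0`. Once `0, …, i` have been used and edges
remain, take among the edges labelled `0, …, i` that end in an active node the one with the highest
label; the leftmost unlabelled output of that node gets the label `i + 1`. -/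
def PlaneGraph.IsDepthLeftFirst (G : PlaneGraph) (ℓ : ℕ → ℕ) : Prop :=
  Set.BijOn ℓ (Set.Iio G.numEdges) (Set.Iio G.numEdges) ∧
  (∀ e ∈ G.inputs, ℓ e = 0) ∧
  ∀ i, i + 1 < G.numEdges →
    ∃ v, G.IsActive ℓ i v ∧
      (∃ e ∈ v.ins, ∀ v', G.IsActive ℓ i v' → ∀ e' ∈ v'.ins, ℓ e' ≤ ℓ e) ∧
      ∃ x, v.outs.find? (fun y => decide (i < ℓ y)) = some x ∧ ℓ x = i + 1

/-! ### The map from prographs to tableaux -/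

/-- The row of the tableau for the edge `e`: row `0` for leftmost coproduct children, row `1` for
all other coproduct children, row `2` for product children. -/
def PlaneGraph.InRow (G : PlaneGraph) (e : ℕ) : ℕ → Prop
  | 0 => ∃ v ∈ G.nodes, v.op = .coprod ∧ v.outs.head? = some e
  | 1 => ∃ v ∈ G.nodes, v.op = .coprod ∧ e ∈ v.outs.tail
  | 2 => ∃ v ∈ G.nodes, v.op = .prod ∧ e ∈ v.outs
  | _ => False

/-- `T` is the tableau read off from the edge labelling `ℓ` of `G`: every entry `a` is the label of
an edge, it is in the row of that edge, and each row `r` is filled in increasing order from left to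
right with `ρ r` labels in each cell (so that the column of `a`, counted from `0`, is the number of
smaller labels that belong to the same row, divided by `ρ r` and rounded down). -/
def IsTableauOf {μ : YoungDiagram} {ρ : ℕ → ℕ} (T : SetValuedSYT μ ρ) (G : PlaneGraph)
    (ℓ : ℕ → ℕ) : Prop :=
  ∀ a : Finset.Icc 1 (∑ c ∈ μ.cells, ρ c.1), ∃ e r, e < G.numEdges ∧ ℓ e = (a : ℕ) ∧ G.InRow e r ∧
    T.cell a = (r, {e' | e' < G.numEdges ∧ G.InRow e' r ∧ ℓ e' < ℓ e}.ncard / ρ r)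

end Prograph

namespace Prograph

/-! ### Sweeping a plane graph from the left -/

/-! A closed prograph can be drawn from left to right by one deterministic process. Cut the current
row of strands into a visited left part and a pending right part. At each moment the process applies
a coproduct to the last visited strand, visits the next pending strand, or applies a product to the
last `k` visited strands. Writing `0`, `1`, `2` for these moves gives a word `u`, and each move
visits exactly one new edge, namely an edge of tableau row `0`, `1`, `2` respectively.

Every composition admits such a sweep (`exists_sweep`): its stages are absorbed one at a time from
the top, each node being delayed until the sweep reaches its output. The order of visits is a
depth-left first labelling (`Sweep.searchStep`), and that labelling is unique
(`IsDepthLeftFirst.unique`), so the word depends on the graph alone. Conversely, the word determines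
the graph up to renaming of the edges (`Sweep.map_eq`). Hence prographs correspond to the words that
occur.

A word occurs exactly when the process never runs out of pending strands or of visited strands.
These two conditions are the inequalities of `IsBallot`; they are necessary by counting strands
along a sweep and sufficient by `exists_composition`. They are also what column-standardness says
about the word recording the row of each entry of a tableau, while row-standardness makes the
tableau recoverable from that word (`tableau_column_eq`).

For `k = 2` the words are three-letter ballot words. Removing the last letter gives a recurrence on
the letter counts, which the hook length expression `ballotNumber` also satisfies. -/

/-- `Sweep k u L R tr N out`: starting from the strands `L.reverse ++ R`, where those in `L` have
already been visited (the last one at the head of `L`), the instructions `u` draw the nodes `N` and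
end with the strands `out`, all visited. The instruction `0` applies a coproduct to the last visited
strand and visits its leftmost child, `1` visits the first pending strand of `R`, and `2` applies a
product to the last `k` visited strands and visits its child. The list `tr` records the strands in
the order of their visits. -/
inductive Sweep (k : ℕ) :
    List ℕ → List ℕ → List ℕ → List ℕ → List Node → List ℕ → Prop
  | nil (L : List ℕ) : Sweep k [] L [] [] [] L.reverse
  | coprod {u L R tr N out} (e c : ℕ) (cs : List ℕ) (hk : cs.length + 1 = k)
      (h : Sweep k u (c :: L) (cs ++ R) tr N out) :
      Sweep k (0 :: u) (e :: L) R (c :: tr) (⟨.coprod, [e], c :: cs⟩ :: N) out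
  | next {u L R tr N out} (x : ℕ) (h : Sweep k u (x :: L) R tr N out) :
      Sweep k (1 :: u) L (x :: R) (x :: tr) N out
  | prod {u L R tr N out} (es : List ℕ) (c : ℕ) (hk : es.length = k)
      (h : Sweep k u (c :: L) R tr N out) :
      Sweep k (2 :: u) (es.reverse ++ L) R (c :: tr) (⟨.prod, es, [c]⟩ :: N) out

namespace Sweep

variable {k : ℕ} {u L R tr out : List ℕ} {N : List Node}

theorem length_trace (h : Sweep k u L R tr N out) : tr.length = u.length := by
  induction h <;> simp_all

theorem map (σ : ℕ → ℕ) (h : Sweep k u L R tr N out) :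
    Sweep k u (L.map σ) (R.map σ) (tr.map σ) (N.map (Node.map σ)) (out.map σ) := by
  induction h with
  | nil L => simpa using Sweep.nil (L.map σ)
  | coprod e c cs hk h ih =>
    simpa [Node.map] using Sweep.coprod (σ e) (σ c) (cs.map σ) (by simpa using hk)
      (by simpa using ih)
  | next x h ih => simpa using Sweep.next (σ x) (by simpa using ih)
  | prod es c hk h ih =>
    simpa [Node.map] using Sweep.prod (es.map σ) (σ c) (by simpa using hk) (by simpa using ih)

/-- A pending strand is untouched until a `next` move visits it. When that happens to `c`, the sweep
can instead visit `e` and then apply the new coproduct, after which it is in the same state. Earlier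
moves only change the pending prefix `T`. -/
theorem insert_coprod {T q cs : List ℕ} {c : ℕ} (e : ℕ) (hk : cs.length + 1 = k)
    (h : Sweep k u L (T ++ c :: (cs ++ q)) tr N out) :
    ∃ u' tr' N', Sweep k u' L (T ++ e :: q) tr' N' out ∧
      N'.Perm (⟨.coprod, [e], c :: cs⟩ :: N) := by
  generalize hR : T ++ c :: (cs ++ q) = R at h
  induction h generalizing T with
  | nil L => simp at hR
  | coprod e' c' cs' hk' h ih =>
    subst hR
    obtain ⟨u', tr', N', h', hp⟩ := ih (T := cs' ++ T) (by simp)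
    exact ⟨_, _, _, .coprod e' c' cs' hk' (by simpa using h'), (hp.cons _).trans (.swap _ _ _)⟩
  | next x h ih =>
    cases T with
    | nil =>
      simp only [List.nil_append, List.cons.injEq] at hR
      obtain ⟨rfl, rfl⟩ := hR
      exact ⟨_, _, _, .next e (.coprod e c cs hk h), .refl _⟩
    | cons t T =>
      simp only [List.cons_append, List.cons.injEq] at hR
      obtain ⟨rfl, hR⟩ := hR
      obtain ⟨u', tr', N', h', hp⟩ := ih hR
      exact ⟨_, _, _, .next t h', hp⟩
  | prod es c' hk' h ih =>
    obtain ⟨u', tr', N', h', hp⟩ := ih hR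
    exact ⟨_, _, _, .prod es c' hk' h', (hp.cons _).trans (.swap _ _ _)⟩

theorem visit_all (es : List ℕ) (h : Sweep k u (es.reverse ++ L) R tr N out) :
    ∃ u' tr', Sweep k u' L (es ++ R) tr' N out := by
  induction es generalizing L with
  | nil => exact ⟨u, tr, by simpa using h⟩
  | cons e es ih =>
    obtain ⟨u', tr', h'⟩ := ih (L := e :: L) (by simpa using h)
    exact ⟨_, _, .next e h'⟩

/-- As for `insert_coprod`: the visit of `c` is replaced by visits of all of `es` followed by the
product. -/
theorem insert_prod {T q : List ℕ} {c : ℕ} (es : List ℕ) (hk : es.length = k)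
    (h : Sweep k u L (T ++ c :: q) tr N out) :
    ∃ u' tr' N', Sweep k u' L (T ++ es ++ q) tr' N' out ∧
      N'.Perm (⟨.prod, es, [c]⟩ :: N) := by
  generalize hR : T ++ c :: q = R at h
  induction h generalizing T with
  | nil L => simp at hR
  | coprod e' c' cs' hk' h ih =>
    subst hR
    obtain ⟨u', tr', N', h', hp⟩ := ih (T := cs' ++ T) (by simp)
    exact ⟨_, _, _, .coprod e' c' cs' hk' (by simpa using h'), (hp.cons _).trans (.swap _ _ _)⟩
  | next x h ih =>
    cases T with
    | nil =>
      simp only [List.nil_append, List.cons.injEq] at hR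
      obtain ⟨rfl, rfl⟩ := hR
      obtain ⟨u', tr', h'⟩ := visit_all es (.prod es c hk h)
      exact ⟨_, _, _, by simpa using h', .refl _⟩
    | cons t T =>
      simp only [List.cons_append, List.cons.injEq] at hR
      obtain ⟨rfl, hR⟩ := hR
      obtain ⟨u', tr', N', h', hp⟩ := ih hR
      exact ⟨_, _, _, .next t h', hp⟩
  | prod es' c' hk' h ih =>
    obtain ⟨u', tr', N', h', hp⟩ := ih hR
    exact ⟨_, _, _, .prod es' c' hk' h', (hp.cons _).trans (.swap _ _ _)⟩

end Sweep

/-! ### From compositions to sweeps -/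

theorem length_drawStage (k : ℕ) (s : List Op) (xs : List ℕ) (f : ℕ)
    (h : (s.map (Op.arity k)).sum = xs.length) :
    (drawStage k s xs f).2.1.length = (s.map (Op.coarity k)).sum := by
  induction s generalizing xs f with
  | nil => simp [drawStage]
  | cons o s ih =>
    simp only [List.map_cons, List.sum_cons] at h
    cases o <;> simp only [drawStage, Op.arity, Op.coarity, List.map_cons, List.sum_cons,
      List.length_append, List.length_range', List.length_take, List.length_singleton] at h ⊢ <;>
    rw [ih _ _ (by simp; omega)]
    omega

/-- The operators of a stage act on disjoint blocks of strands, so they can be inserted into the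
sweep separately. `P` holds the strands to the left of the part of the stage under treatment; the
rightmost operators are inserted first. -/
theorem Sweep.precomp_stage {k : ℕ} (hk : 1 ≤ k) (s : List Op) {u tr N out} (P xs : List ℕ) (f : ℕ)
    (hs : (s.map (Op.arity k)).sum = xs.length)
    (h : Sweep k u [] (P ++ (drawStage k s xs f).2.1) tr N out) :
    ∃ u' tr' N', Sweep k u' [] (P ++ xs) tr' N' out ∧
      N'.Perm ((drawStage k s xs f).1 ++ N) := by
  induction s generalizing P xs f with
  | nil =>
    obtain rfl : xs = [] := by simpa using hs.symm
    exact ⟨u, tr, N, by simpa [drawStage] using h, by simp [drawStage]⟩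
  | cons o s ih =>
    simp only [List.map_cons, List.sum_cons] at hs
    cases o with
    | id =>
      obtain ⟨x, xs, rfl⟩ : ∃ x xs', xs = x :: xs' := by
        cases xs with
        | nil => simp [Op.arity] at hs
        | cons x xs => exact ⟨x, xs, rfl⟩
      obtain ⟨u', tr', N', h', hp⟩ := ih (P ++ [x]) xs f (by simp [Op.arity] at hs; omega)
        (by simpa [drawStage] using h)
      exact ⟨u', tr', N', by simpa using h', by simpa [drawStage] using hp⟩
    | coprod =>
      obtain ⟨x, xs, rfl⟩ : ∃ x xs', xs = x :: xs' := by
        cases xs with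
        | nil => simp [Op.arity] at hs
        | cons x xs => exact ⟨x, xs, rfl⟩
      obtain ⟨u', tr', N', h', hp⟩ := ih (P ++ List.range' f k) xs (f + k)
        (by simp [Op.arity] at hs; omega) (by simpa [drawStage] using h)
      obtain ⟨d, rfl⟩ : ∃ d, k = d + 1 := ⟨k - 1, by omega⟩
      rw [List.range'_succ] at h'
      obtain ⟨u'', tr'', N'', h'', hp'⟩ := Sweep.insert_coprod (T := P) (q := xs)
        (cs := List.range' (f + 1) d) (c := f) (k := d + 1) x (by simp) (by simpa using h')
      refine ⟨u'', tr'', N'', h'', hp'.trans ?_⟩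
      simpa [drawStage, List.range'_succ] using hp
    | prod =>
      simp only [Op.arity] at hs
      obtain ⟨u', tr', N', h', hp⟩ := ih (P ++ [f]) (xs.drop k) (f + 1)
        (by simp; omega) (by simpa [drawStage] using h)
      obtain ⟨u'', tr'', N'', h'', hp'⟩ := Sweep.insert_prod (T := P) (q := xs.drop k) (c := f)
        (k := k) (xs.take k) (by simp; omega) (by simpa using h')
      refine ⟨u'', tr'', N'', by simpa using h'', hp'.trans ?_⟩
      simpa [drawStage] using hp

/-- Every composition can be drawn by a sweep. -/
theorem exists_sweep {k : ℕ} (hk : 1 ≤ k) (w : Composition) (xs : List ℕ) (f b : ℕ)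
    (hw : IsComposable k xs.length w b) :
    ∃ u tr N, Sweep k u [] xs tr N (draw k w xs f).2.1 ∧ N.Perm (draw k w xs f).1 := by
  induction w generalizing xs f with
  | nil =>
    obtain ⟨u', tr', h'⟩ := Sweep.visit_all (L := []) xs (.nil (k := k) (xs.reverse ++ []))
    exact ⟨u', tr', [], by simpa [draw] using h', by simp [draw]⟩
  | cons s w ih =>
    obtain ⟨hs, hw⟩ := hw
    rw [← length_drawStage k s xs f hs] at hw
    obtain ⟨u', tr', N', h', hp⟩ := ih _ (drawStage k s xs f).2.2 hw
    obtain ⟨u'', tr'', N'', h'', hp'⟩ := Sweep.precomp_stage hk s [] xs f hs (by simpa using h')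
    exact ⟨u'', tr'', N'', by simpa [draw] using h'',
      by simpa [draw] using hp'.trans (hp.append_left _)⟩

/-! ### The edges of a drawing -/

theorem outs_drawStage (k : ℕ) (s : List Op) (xs : List ℕ) (f : ℕ) :
    ∃ m, (drawStage k s xs f).2.2 = f + m ∧
      (drawStage k s xs f).1.flatMap Node.outs = List.range' f m := by
  induction s generalizing xs f with
  | nil => exact ⟨0, by simp [drawStage]⟩
  | cons o s ih =>
    cases o with
    | id => exact ih _ _
    | coprod =>
      obtain ⟨m, h, h'⟩ := ih (xs.drop 1) (f + k)
      refine ⟨k + m, by simp only [drawStage, h, add_assoc], ?_⟩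
      simp only [drawStage, List.flatMap_cons, h', List.range'_append_1]
    | prod =>
      obtain ⟨m, h, h'⟩ := ih (xs.drop k) (f + 1)
      refine ⟨1 + m, by simp only [drawStage, h, add_assoc], ?_⟩
      simp [drawStage, h', add_comm 1 m, List.range'_succ]

theorem outs_draw (k : ℕ) (w : Composition) (xs : List ℕ) (f : ℕ) :
    ∃ m, (draw k w xs f).2.2 = f + m ∧
      (draw k w xs f).1.flatMap Node.outs = List.range' f m := by
  induction w generalizing xs f with
  | nil => exact ⟨0, by simp [draw]⟩
  | cons s w ih =>
    obtain ⟨m, h, h'⟩ := outs_drawStage k s xs f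
    obtain ⟨m', g, g'⟩ := ih (drawStage k s xs f).2.1 (drawStage k s xs f).2.2
    refine ⟨m + m', by simp only [draw, g]; rw [h, add_assoc], ?_⟩
    simp only [draw, List.flatMap_append, h', g']
    rw [h, List.range'_append_1]

namespace Sweep

variable {k : ℕ} {u L R tr out : List ℕ} {N : List Node}

/-- Each edge is visited once: it is either pending at the start or emitted by exactly one node
drawn later. -/
theorem trace_perm (h : Sweep k u L R tr N out) : tr.Perm (R ++ N.flatMap Node.outs) := by
  induction h with
  | nil L => simp
  | coprod e c cs hk h ih =>
    refine (ih.cons c).trans ?_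
    simp only [List.flatMap_cons, List.cons_append]
    refine .trans ?_ List.perm_middle.symm
    refine .cons _ ?_
    simp only [← List.append_assoc]
    exact List.perm_append_comm.append_right _
  | next x h ih => exact ih.cons x
  | prod es c hk h ih =>
    refine (ih.cons c).trans ?_
    simp only [List.flatMap_cons, List.cons_append, List.nil_append]
    exact List.perm_middle.symm

/-- Each strand ends once, either at the top of the picture or as an input of one node. -/
theorem ins_perm (h : Sweep k u L R tr N out) :
    (L ++ tr).Perm (out ++ N.flatMap Node.ins) := by
  induction h with
  | nil L => simp
  | coprod e c cs hk h ih =>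
    simp only [List.flatMap_cons, List.cons_append, List.nil_append]
    refine .trans (.cons _ ?_) List.perm_middle.symm
    exact List.perm_middle.trans ih
  | next x h ih => exact List.perm_middle.trans ih
  | @prod u L R tr N out es c hk h ih =>
    simp only [List.flatMap_cons]
    have h1 : (L ++ c :: tr).Perm (out ++ N.flatMap Node.ins) := List.perm_middle.trans ih
    rw [List.append_assoc]
    refine (h1.append_left _).trans ?_
    refine (es.reverse_perm.append_right _).trans ?_
    simp only [← List.append_assoc]
    exact List.perm_append_comm.append_right _

end Sweep

end Prograph

namespace Prograph

/-! ### Sweeps and the depth-left first search -/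

/-- The condition on the labelling `ℓ` for the step of the search that uses the label `i + 1`. -/
def PlaneGraph.SearchStep (G : PlaneGraph) (ℓ : ℕ → ℕ) (i : ℕ) : Prop :=
  ∃ v, G.IsActive ℓ i v ∧
    (∃ e ∈ v.ins, ∀ v', G.IsActive ℓ i v' → ∀ e' ∈ v'.ins, ℓ e' ≤ ℓ e) ∧
    ∃ x, v.outs.find? (fun y => decide (i < ℓ y)) = some x ∧ ℓ x = i + 1

namespace Sweep

variable {k : ℕ} {u L R tr out : List ℕ} {N : List Node}

/-- Every node consumes the strand visited last before it is drawn. That strand is the present head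
of `L` or is visited later. Thus a node not yet drawn cannot have had all its inputs labelled before
that head was visited. -/
theorem exists_input_visited (hk : 1 ≤ k) (h : Sweep k u L R tr N out) :
    ∀ x L', L = x :: L' → ∀ v ∈ N, ∃ e ∈ v.ins, e ∈ x :: tr := by
  induction h with
  | nil L => simp
  | coprod e c cs hk' h ih =>
    rintro x L' ⟨⟩ v hv
    rcases List.mem_cons.1 hv with rfl | hv
    · exact ⟨e, by simp⟩
    · obtain ⟨e', he', hm⟩ := ih _ _ rfl v hv
      exact ⟨e', he', List.mem_cons_of_mem _ hm⟩
  | next y h ih =>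
    rintro x L' rfl v hv
    obtain ⟨e', he', hm⟩ := ih _ _ rfl v hv
    exact ⟨e', he', List.mem_cons_of_mem _ hm⟩
  | prod es c hk' h ih =>
    intro x L' hL v hv
    rcases List.mem_cons.1 hv with rfl | hv
    · obtain ⟨a, t, ht⟩ : ∃ a t, es.reverse = a :: t := by
        refine List.exists_cons_of_ne_nil ?_
        rintro hnil
        simp only [List.reverse_eq_nil_iff] at hnil
        simp [hnil] at hk'
        omega
      rw [ht, List.cons_append, List.cons.injEq] at hL
      exact ⟨x, by rw [← List.mem_reverse, ht, hL.1]; simp, by simp⟩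
    · obtain ⟨e', he', hm⟩ := ih _ _ rfl v hv
      exact ⟨e', he', List.mem_cons_of_mem _ hm⟩

/-- A labelling in the order of the visits of a sweep satisfies the condition of the search. The
list `bs` holds, for each coproduct that is already drawn and has pending children, its input, its
visited children and its pending children. -/
theorem searchStep (hk : 2 ≤ k) {G : PlaneGraph} {ℓ : ℕ → ℕ} (h : Sweep k u L R tr N out) :
    ∀ (i : ℕ) (D : List Node) (bs : List (ℕ × List ℕ × List ℕ)),
    (∀ v, v ∈ G.nodes ↔ v ∈ D ∨ v ∈ N) →
    (∀ j (hj : j < tr.length), ℓ tr[j] = i + 1 + j) →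
    (∀ e ∈ L, ℓ e ≤ i) → (∀ e ∈ L.head?, ℓ e = i) →
    (∀ v ∈ D, ∀ e ∈ v.ins, ℓ e ≤ i) →
    R = bs.flatMap (fun b => b.2.2) →
    (∀ b ∈ bs, ⟨.coprod, [b.1], b.2.1 ++ b.2.2⟩ ∈ D ∧ (∀ y ∈ b.2.1, ℓ y ≤ i) ∧ b.2.2 ≠ []) →
    bs.Pairwise (fun b b' => ℓ b'.1 ≤ ℓ b.1) →
    (∀ v ∈ D, (∃ e ∈ v.outs, i < ℓ e) → ∃ b ∈ bs, v = ⟨.coprod, [b.1], b.2.1 ++ b.2.2⟩) →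
    ∀ j, i ≤ j → j < i + tr.length → G.SearchStep ℓ j := by
  induction h with
  | nil L => intros; simp at *; omega
  | @coprod u L R tr N out e c cs hk' h ih =>
    intro i D bs hG htr hL htop hD hR hb hord hact j hij hj
    have hc : ℓ c = i + 1 := htr 0 (by simp)
    have he : ℓ e = i := htop e (by simp)
    rcases hij.eq_or_lt with rfl | hij
    -- The input `e` carries the label `i`, the largest one used, so this active node wins without
    -- comparison.
    · refine ⟨⟨.coprod, [e], c :: cs⟩, ⟨(hG _).2 (by simp), by simp [he], c, by simp, by omega⟩,
        ⟨e, by simp, fun v' hv' e' he' => he ▸ hv'.2.1 e' he'⟩, c, by simp [hc], hc⟩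
    · refine ih (i + 1) (⟨.coprod, [e], c :: cs⟩ :: D) ((e, [c], cs) :: bs) ?_ ?_ ?_ ?_ ?_ ?_ ?_ ?_
        ?_ j hij (by simp at hj; omega)
      · intro v
        rw [hG, List.mem_cons, List.mem_cons]
        tauto
      · intro j hj
        have := htr (j + 1) (by simpa using hj)
        simp only [List.getElem_cons_succ] at this
        omega
      · intro e' he'
        rcases List.mem_cons.1 he' with rfl | he'
        · omega
        · have := hL e' (by simp [he'])
          omega
      · simp [hc]
      · intro v hv e' he'
        rcases List.mem_cons.1 hv with rfl | hv
        · obtain rfl : e' = e := by simpa using he'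
          omega
        · have := hD v hv e' he'
          omega
      · simp [hR]
      · intro b hb'
        rcases List.mem_cons.1 hb' with rfl | hb'
        -- The new block has pending children because `k ≥ 2`.
        · refine ⟨by simp, by simp [hc], ?_⟩
          rintro rfl
          simp at hk'
          omega
        · obtain ⟨h1, h2, h3⟩ := hb b hb'
          exact ⟨by simp [h1], fun y hy => (h2 y hy).trans (by omega), h3⟩
      · refine List.pairwise_cons.2 ⟨fun b hb' => ?_, hord⟩
        simpa [he] using hD _ (hb b hb').1 b.1
      · rintro v hv ⟨y, hy, hy'⟩
        rcases List.mem_cons.1 hv with rfl | hv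
        · exact ⟨(e, [c], cs), by simp, by simp⟩
        · obtain ⟨b, hb', rfl⟩ := hact v hv ⟨y, hy, by omega⟩
          exact ⟨b, by simp [hb'], rfl⟩
  | @next u L R tr N out x h ih =>
    intro i D bs hG htr hL htop hD hR hb hord hact j hij hj
    have hx : ℓ x = i + 1 := htr 0 (by simp)
    -- The next pending strand belongs to the first block, whose coproduct has the largest input
    -- label among the open ones.
    obtain ⟨⟨e, a, p⟩, bs, rfl⟩ : ∃ b bs', bs = b :: bs' :=
      List.exists_cons_of_ne_nil (by rintro rfl; simp at hR)
    obtain ⟨y, p, rfl⟩ : ∃ y p', p = y :: p' :=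
      List.exists_cons_of_ne_nil (hb (e, a, p) (by simp)).2.2
    simp only [List.flatMap_cons, List.cons_append, List.cons.injEq] at hR
    obtain ⟨rfl, hR⟩ := hR
    obtain ⟨hv, ha, -⟩ := hb _ (List.mem_cons_self ..)
    simp only at hv ha
    have hord' := List.pairwise_cons.1 hord
    rcases hij.eq_or_lt with rfl | hij
    · refine ⟨_, ⟨(hG _).2 (.inl hv), hD _ hv, x, by simp, by omega⟩,
        ⟨e, by simp, fun v' hv' e' he' => ?_⟩, x, ?_, hx⟩
      · rcases (hG v').1 hv'.1 with hv'' | hv''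
        · obtain ⟨b, hb', rfl⟩ := hact v' hv'' hv'.2.2
          obtain rfl : e' = b.1 := by simpa using he'
          rcases List.mem_cons.1 hb' with rfl | hb'
          · rfl
          · exact hord'.1 b hb'
        -- A node not yet drawn has an input with label above `i`, so it is not active.
        · obtain ⟨e₀, he₀, hm⟩ := h.exists_input_visited (by omega) x L rfl v' hv''
          obtain ⟨j, hj, rfl⟩ := List.getElem_of_mem hm
          have h1 := htr j hj
          have h2 := hv'.2.1 _ he₀
          omega
      · simp only
        rw [List.find?_append, List.find?_eq_none.2 (by simpa using ha)]
        simp [hx]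
    · have key : ∀ bs₁ : List (ℕ × List ℕ × List ℕ), R = bs₁.flatMap (fun b => b.2.2) →
          (∀ b ∈ bs₁, ⟨.coprod, [b.1], b.2.1 ++ b.2.2⟩ ∈ D ∧ (∀ y ∈ b.2.1, ℓ y ≤ i + 1) ∧
            b.2.2 ≠ []) →
          bs₁.Pairwise (fun b b' => ℓ b'.1 ≤ ℓ b.1) →
          (∀ v ∈ D, (∃ e ∈ v.outs, i + 1 < ℓ e) →
            ∃ b ∈ bs₁, v = ⟨.coprod, [b.1], b.2.1 ++ b.2.2⟩) → G.SearchStep ℓ j := by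
        intro bs₁ h1 h2 h3 h4
        refine ih (i + 1) D bs₁ hG ?_ ?_ ?_ ?_ h1 h2 h3 h4 j hij (by simp at hj; omega)
        · intro j hj
          have := htr (j + 1) (by simpa using hj)
          simp only [List.getElem_cons_succ] at this
          omega
        · intro e' he'
          rcases List.mem_cons.1 he' with rfl | he'
          · omega
          · have := hL e' he'
            omega
        · simp [hx]
        · intro v hv e' he'
          have := hD v hv e' he'
          omega
      have hb' : ∀ b ∈ bs, ⟨.coprod, [b.1], b.2.1 ++ b.2.2⟩ ∈ D ∧ (∀ y ∈ b.2.1, ℓ y ≤ i + 1) ∧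
          b.2.2 ≠ [] := by
        intro b hb'
        obtain ⟨h1, h2, h3⟩ := hb b (by simp [hb'])
        exact ⟨h1, fun y hy => (h2 y hy).trans (by omega), h3⟩
      have ha' : ∀ y ∈ a ++ [x], ℓ y ≤ i + 1 := by
        intro y hy
        rcases List.mem_append.1 hy with hy | hy
        · exact (ha y hy).trans (by omega)
        · obtain rfl : y = x := by simpa using hy
          omega
      -- If `x` was the last pending child, its coproduct stops being active and the block is
      -- dropped; otherwise `x` moves to the visited children of the block.
      cases p with
      | nil =>
        refine key bs (by simpa using hR) hb' hord'.2 ?_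
        rintro v hv ⟨y, hy, hy'⟩
        obtain ⟨b, hb'', rfl⟩ := hact v hv ⟨y, hy, by omega⟩
        rcases List.mem_cons.1 hb'' with rfl | hb''
        · have := ha' y hy
          omega
        · exact ⟨b, hb'', rfl⟩
      | cons z p =>
        refine key ((e, a ++ [x], z :: p) :: bs) (by simpa using hR) ?_ ?_ ?_
        · intro b hb''
          rcases List.mem_cons.1 hb'' with rfl | hb''
          · exact ⟨by simpa using hv, ha', by simp⟩
          · exact hb' b hb''
        · exact List.pairwise_cons.2 hord'
        · rintro v hv ⟨y, hy, hy'⟩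
          obtain ⟨b, hb'', rfl⟩ := hact v hv ⟨y, hy, by omega⟩
          rcases List.mem_cons.1 hb'' with rfl | hb''
          · exact ⟨(e, a ++ [x], z :: p), by simp, by simp⟩
          · exact ⟨b, by simp [hb''], rfl⟩
  | @prod u L R tr N out es c hk' h ih =>
    intro i D bs hG htr hL htop hD hR hb hord hact j hij hj
    have hc : ℓ c = i + 1 := htr 0 (by simp)
    obtain ⟨e, t, ht⟩ : ∃ e t, es.reverse = e :: t := by
      refine List.exists_cons_of_ne_nil fun hnil => ?_
      simp only [List.reverse_eq_nil_iff] at hnil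
      simp [hnil] at hk'
      omega
    have he : ℓ e = i := htop e (by simp [ht])
    have hmem : e ∈ es := by rw [← List.mem_reverse, ht]; simp
    have hes : ∀ e' ∈ es, ℓ e' ≤ i := fun e' he' => hL e' (by simp [he'])
    rcases hij.eq_or_lt with rfl | hij
    · refine ⟨⟨.prod, es, [c]⟩, ⟨(hG _).2 (by simp), hes, c, by simp, by omega⟩,
        ⟨e, hmem, fun v' hv' e' he' => he ▸ hv'.2.1 e' he'⟩, c, by simp [hc], hc⟩
    · refine ih (i + 1) (⟨.prod, es, [c]⟩ :: D) bs ?_ ?_ ?_ ?_ ?_ hR ?_ hord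
        ?_ j hij (by simp at hj; omega)
      · intro v
        rw [hG, List.mem_cons, List.mem_cons]
        tauto
      · intro j hj
        have := htr (j + 1) (by simpa using hj)
        simp only [List.getElem_cons_succ] at this
        omega
      · intro e' he'
        rcases List.mem_cons.1 he' with rfl | he'
        · omega
        · have := hL e' (by simp [he'])
          omega
      · simp [hc]
      · intro v hv e' he'
        rcases List.mem_cons.1 hv with rfl | hv
        · have := hes e' he'
          omega
        · have := hD v hv e' he'
          omega
      · intro b hb'
        obtain ⟨h1, h2, h3⟩ := hb b hb'
        exact ⟨by simp [h1], fun y hy => (h2 y hy).trans (by omega), h3⟩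
      · rintro v hv ⟨y, hy, hy'⟩
        rcases List.mem_cons.1 hv with rfl | hv
        · obtain rfl : y = c := by simpa using hy
          omega
        · exact hact v hv ⟨y, hy, by omega⟩

/-- A coproduct visits its leftmost child at once, so the strands it leaves pending are exactly the
children of row `1`. The hypothesis on `R` is this invariant. -/
theorem inRow {G : PlaneGraph} (h : Sweep k u L R tr N out) (hN : ∀ v ∈ N, v ∈ G.nodes)
    (hR : ∀ x ∈ R, G.InRow x 1) :
    ∀ j (hj : j < tr.length) (hj' : j < u.length), G.InRow tr[j] u[j] := by
  induction h with
  | nil L => simp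
  | coprod e c cs hk h ih =>
    rintro (_ | j) hj hj'
    · exact ⟨_, hN _ List.mem_cons_self, rfl, rfl⟩
    · simp only [List.getElem_cons_succ]
      refine ih (fun v hv => hN v (List.mem_cons_of_mem _ hv)) (fun x hx => ?_) j _ _
      rcases List.mem_append.1 hx with hx | hx
      · exact ⟨_, hN _ List.mem_cons_self, rfl, hx⟩
      · exact hR x hx
  | next x h ih =>
    rintro (_ | j) hj hj'
    · exact hR x List.mem_cons_self
    · exact ih hN (fun y hy => hR y (List.mem_cons_of_mem _ hy)) j _ _
  | prod es c hk h ih =>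
    rintro (_ | j) hj hj'
    · exact ⟨_, hN _ List.mem_cons_self, rfl, List.mem_cons_self⟩
    · exact ih (fun v hv => hN v (List.mem_cons_of_mem _ hv)) hR j _ _

theorem lt_three (h : Sweep k u L R tr N out) : ∀ x ∈ u, x < 3 := by
  induction h <;> simp_all

/-- The nodes drawn by a sweep are determined by the instructions and the order of the visits. -/
theorem map_eq {σ : ℕ → ℕ} {L' R' tr' out' : List ℕ} {N' : List Node}
    (h : Sweep k u L R tr N out) (h' : Sweep k u L' R' tr' N' out') (hL : L.length = L'.length)
    (hR : R.length = R'.length) (htr : tr.map σ = tr') :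
    R.map σ = R' ∧ (L.map σ = L' → N.map (Node.map σ) = N' ∧ out.map σ = out') := by
  induction h generalizing L' R' tr' N' out' with
  | nil L =>
    cases h'
    simp only [List.map_nil, List.map_reverse, List.reverse_inj, true_and, imp_self]
  | coprod e c cs hk h ih =>
    cases h' with
    | coprod e' c' cs' hk' h' =>
      simp only [List.map_cons, List.cons.injEq, List.length_cons] at htr hL
      have hcs : cs.length = cs'.length := by omega
      obtain ⟨h1, h2⟩ := ih h' (by simpa using hL) (by simp [hcs, hR]) htr.2
      rw [List.map_append] at h1
      obtain ⟨h3, h4⟩ := List.append_inj h1 (by simpa using hcs)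
      refine ⟨h4, fun hL' => ?_⟩
      simp only [List.map_cons, List.cons.injEq] at hL'
      obtain ⟨h5, h6⟩ := h2 (by simp [htr.1, hL'.2])
      simp [h5, h6, h3, htr.1, hL'.1, Node.map]
  | next x h ih =>
    cases h' with
    | next x' h' =>
      simp only [List.map_cons, List.cons.injEq, List.length_cons] at htr hR
      obtain ⟨h1, h2⟩ := ih h' (by simp [hL]) (by omega) htr.2
      exact ⟨by simp [htr.1, h1], fun hL' => h2 (by simp [htr.1, hL'])⟩
  | prod es c hk h ih =>
    cases h' with
    | prod es' c' hk' h' =>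
      simp only [List.map_cons, List.cons.injEq, List.length_append, List.length_reverse]
        at htr hL
      have hes : es.length = es'.length := by omega
      obtain ⟨h1, h2⟩ := ih h' (by simp; omega) hR htr.2
      refine ⟨h1, fun hL' => ?_⟩
      rw [List.map_append] at hL'
      obtain ⟨h3, h4⟩ := List.append_inj hL' (by simpa using hes)
      rw [List.map_reverse, List.reverse_inj] at h3
      obtain ⟨h5, h6⟩ := h2 (by simp [htr.1, h4])
      simp [h5, h6, h3, htr.1, Node.map]

end Sweep

end Prograph

namespace Prograph

/-! ### The words of a closed composition -/

/-- A permutation of an initial segment of `ℕ`, given as a list, extends to a permutation of `ℕ`. -/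
theorem exists_perm_eq_getElem {l : List ℕ} {E : ℕ} (h : l.Perm (List.range E)) :
    ∃ τ : Equiv.Perm ℕ, (∀ i, τ i < E ↔ i < E) ∧ ∀ i (hi : i < l.length), τ i = l[i] := by
  have hlen : l.length = E := by simpa using h.length_eq
  have hmem : ∀ x, x ∈ l ↔ x < E := fun x => by rw [h.mem_iff, List.mem_range]
  have hnd : l.Nodup := h.nodup_iff.2 List.nodup_range
  let f : ℕ → ℕ := fun i => if hi : i < l.length then l[i] else i
  have hf : ∀ i (hi : i < l.length), f i = l[i] := fun i hi => dif_pos hi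
  have hf' : ∀ i, ¬ i < l.length → f i = i := fun i hi => dif_neg hi
  have hlt : ∀ i, f i < E ↔ i < E := by
    intro i
    by_cases hi : i < l.length
    · rw [hf i hi, ← hmem]
      simp [hlen ▸ hi]
    · rw [hf' i hi]
  have hbij : Function.Bijective f := by
    constructor
    · intro i j hij
      by_cases hi : i < l.length
      · have hj : j < l.length := by
          rw [hlen] at hi ⊢
          rwa [← hlt, ← hij, hlt]
        rw [hf i hi, hf j hj] at hij
        exact (List.Nodup.getElem_inj_iff hnd).1 hij
      · have hj : ¬ j < l.length := by
          rw [hlen] at hi ⊢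
          rwa [← hlt, ← hij, hlt]
        rwa [hf' i hi, hf' j hj] at hij
    · intro x
      by_cases hx : x < E
      · obtain ⟨i, hi, rfl⟩ := List.getElem_of_mem ((hmem x).2 hx)
        exact ⟨i, hf i hi⟩
      · exact ⟨x, hf' x (hlen ▸ hx)⟩
  exact ⟨Equiv.ofBijective f hbij, hlt, hf⟩

variable {k n : ℕ}

/-- `u` is the list of instructions of a sweep that draws the closed composition `w`. -/
def IsWord (w : ClosedComposition k n) (u : List ℕ) : Prop :=
  ∃ tr N, Sweep k u [0] [] tr N w.graph.outputs ∧ N.Perm w.graph.nodes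

/-- With nothing visited, the only possible first move is a `next`. Deleting it makes the initial
edge visited from the outset, so the label `0` gets no letter. -/
theorem Sweep.visit_first (hk : 1 ≤ k) {u R tr N out} {x : ℕ}
    (h : Sweep k u [] (x :: R) tr N out) : ∃ u' tr', Sweep k u' [x] R tr' N out := by
  generalize hL : ([] : List ℕ) = L at h
  cases h with
  | coprod => simp at hL
  | next x h =>
    subst hL
    exact ⟨_, _, h⟩
  | prod es c hk' h =>
    have : es = [] := by simpa using (List.append_eq_nil_iff.1 hL.symm).1
    simp [this] at hk'
    omega

theorem exists_isWord (hk : 2 ≤ k) (w : ClosedComposition k n) : ∃ u, IsWord w u := by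
  obtain ⟨u, tr, N, h, hp⟩ := exists_sweep (by omega) w.1 [0] 1 1 w.2.1
  obtain ⟨u, tr, h⟩ := h.visit_first (by omega)
  exact ⟨u, tr, N, h, hp⟩

/-! ### Incidence of edges with nodes and rows -/

theorem Node.mem_outs_flatMap {N : List Node} {v : Node} {e : ℕ} (hv : v ∈ N) (he : e ∈ v.outs) :
    e ∈ N.flatMap Node.outs :=
  List.mem_flatMap.2 ⟨v, hv, he⟩

theorem eq_of_mem_of_nodup_flatMap {α β : Type*} {f : α → List β} {N : List α}
    (h : (N.flatMap f).Nodup) {v v' : α} {e : β} (hv : v ∈ N) (hv' : v' ∈ N) (he : e ∈ f v)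
    (he' : e ∈ f v') : v = v' := by
  by_contra hne
  have hsymm : Std.Symm fun a b : α => (f a).Disjoint (f b) := ⟨fun a b hab => hab.symm⟩
  exact (List.nodup_flatMap.1 h).2.forall hv hv' hne he he'

/-- `draw` names new edges consecutively from `1`, in the order of the nodes. Hence every edge but
`0` leaves exactly one node. -/
theorem closed_edges (w : ClosedComposition k n) :
    (0 :: w.graph.nodes.flatMap Node.outs) = List.range w.graph.numEdges := by
  obtain ⟨m, h, h'⟩ := outs_draw k w.1 [0] 1
  change 0 :: (draw k w.1 [0] 1).1.flatMap Node.outs = List.range (draw k w.1 [0] 1).2.2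
  rw [h, h', add_comm, List.range_eq_range', List.range'_succ]

theorem nodup_outs (w : ClosedComposition k n) : (w.graph.nodes.flatMap Node.outs).Nodup := by
  have h : (0 :: w.graph.nodes.flatMap Node.outs).Nodup := closed_edges w ▸ List.nodup_range
  exact (List.nodup_cons.1 h).2

theorem lt_numEdges_of_mem_outs (w : ClosedComposition k n) {v : Node} {e : ℕ}
    (hv : v ∈ w.graph.nodes) (he : e ∈ v.outs) : e < w.graph.numEdges := by
  rw [← List.mem_range, ← closed_edges w]
  exact List.mem_cons_of_mem _ (Node.mem_outs_flatMap hv he)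

theorem inRow_mem_outs {G : PlaneGraph} {e r : ℕ} (h : G.InRow e r) :
    ∃ v ∈ G.nodes, e ∈ v.outs := by
  match r, h with
  | 0, ⟨v, hv, _, h⟩ => exact ⟨v, hv, List.mem_of_head? h⟩
  | 1, ⟨v, hv, _, h⟩ => exact ⟨v, hv, List.mem_of_mem_tail h⟩
  | 2, ⟨v, hv, _, h⟩ => exact ⟨v, hv, h⟩

/-- An edge belongs to at most one row. -/
theorem inRow_unique (w : ClosedComposition k n) {e r s : ℕ} (hr : w.graph.InRow e r)
    (hs : w.graph.InRow e s) : r = s := by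
  have hnd := nodup_outs w
  have key : ∀ v ∈ w.graph.nodes, ∀ v' ∈ w.graph.nodes, e ∈ v.outs → e ∈ v'.outs → v = v' :=
    fun v hv v' hv' he he' => eq_of_mem_of_nodup_flatMap hnd hv hv' he he'
  have hhead : ∀ v ∈ w.graph.nodes, v.outs.head? = some e → e ∈ v.outs.tail → False := by
    intro v hv h h'
    have h1 : v.outs.Nodup := (List.nodup_flatMap.1 hnd).1 v hv
    obtain ⟨l, hl⟩ := List.head?_eq_some_iff.1 h
    rw [hl] at h1 h'
    exact (List.nodup_cons.1 h1).1 h'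
  match r, s, hr, hs with
  | 0, 0, _, _ => rfl
  | 1, 1, _, _ => rfl
  | 2, 2, _, _ => rfl
  | 0, 1, ⟨v, hv, _, h⟩, ⟨v', hv', _, h'⟩ =>
    obtain rfl := key v hv v' hv' (List.mem_of_head? h) (List.mem_of_mem_tail h')
    exact (hhead v hv h h').elim
  | 1, 0, ⟨v, hv, _, h⟩, ⟨v', hv', _, h'⟩ =>
    obtain rfl := key v hv v' hv' (List.mem_of_mem_tail h) (List.mem_of_head? h')
    exact (hhead v hv h' h).elim
  | 0, 2, ⟨v, hv, ho, h⟩, ⟨v', hv', ho', h'⟩ =>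
    obtain rfl := key v hv v' hv' (List.mem_of_head? h) h'
    simp [ho] at ho'
  | 2, 0, ⟨v, hv, ho, h⟩, ⟨v', hv', ho', h'⟩ =>
    obtain rfl := key v hv v' hv' h (List.mem_of_head? h')
    simp [ho] at ho'
  | 1, 2, ⟨v, hv, ho, h⟩, ⟨v', hv', ho', h'⟩ =>
    obtain rfl := key v hv v' hv' (List.mem_of_mem_tail h) h'
    simp [ho] at ho'
  | 2, 1, ⟨v, hv, ho, h⟩, ⟨v', hv', ho', h'⟩ =>
    obtain rfl := key v hv v' hv' h (List.mem_of_mem_tail h')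
    simp [ho] at ho'

theorem trace_perm_range {w : ClosedComposition k n} {u tr out : List ℕ} {N : List Node}
    (h : Sweep k u [0] [] tr N out) (hp : N.Perm w.graph.nodes) :
    (0 :: tr).Perm (List.range w.graph.numEdges) := by
  rw [← closed_edges w]
  exact (h.trace_perm.trans (hp.flatMap_right _)).cons 0

theorem numEdges_eq_length {w : ClosedComposition k n} {u : List ℕ} (h : IsWord w u) :
    w.graph.numEdges = u.length + 1 := by
  obtain ⟨tr, N, h, hp⟩ := h
  simpa [h.length_trace] using (trace_perm_range h hp).length_eq.symm

/-- A sweep gives a depth-left first search labelling. -/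
theorem IsWord.exists_labelling (hk : 2 ≤ k) {w : ClosedComposition k n} {u : List ℕ}
    (h : IsWord w u) :
    ∃ ℓ : ℕ → ℕ, w.graph.IsDepthLeftFirst ℓ ∧
      ∀ i (hi : i < u.length), ∃ e < w.graph.numEdges, ℓ e = i + 1 ∧ w.graph.InRow e u[i] := by
  have hE := numEdges_eq_length h
  obtain ⟨tr, N, h, hp⟩ := h
  have hlen := h.length_trace
  -- The label of an edge is its position in `0 :: tr`, so the labelling is the inverse of `τ`.
  obtain ⟨τ, hτ, hτ'⟩ := exists_perm_eq_getElem (trace_perm_range h hp)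
  have hlab : ∀ i (hi : i < (0 :: tr).length), τ.symm (0 :: tr)[i] = i := by
    intro i hi
    rw [← hτ' i hi, Equiv.symm_apply_apply]
  have h0 : τ.symm 0 = 0 := hlab 0 (by simp)
  have htr : ∀ i (hi : i < tr.length), τ.symm tr[i] = i + 1 :=
    fun i hi => hlab (i + 1) (by simpa using hi)
  have hlt : ∀ e, τ.symm e < w.graph.numEdges ↔ e < w.graph.numEdges := by
    intro e
    rw [← hτ, Equiv.apply_symm_apply]
  refine ⟨τ.symm, ⟨⟨fun e he => (hlt e).2 he, τ.symm.injective.injOn, fun i hi =>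
    ⟨τ i, (hτ i).2 hi, by simp⟩⟩, ?_, ?_⟩, ?_⟩
  · intro e he
    obtain rfl : e = 0 := by simpa [ClosedComposition.graph, toGraph] using he
    exact h0
  · intro i hi
    refine h.searchStep hk (G := w.graph) (ℓ := τ.symm) 0 [] [] ?_ ?_ ?_ ?_ (by simp) (by simp)
      (by simp) (by simp) (by simp) i (by simp) (by omega)
    · simp [hp.mem_iff]
    · intro j hj
      rw [htr j hj]
      omega
    · simp [h0]
    · simp [h0]
  · intro i hi
    have hrow := h.inRow (G := w.graph) (fun v hv => hp.mem_iff.1 hv) (by simp) i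
      (by omega) hi
    exact ⟨tr[i], (hlt _).1 (by rw [htr i (by omega)]; omega), htr i _, hrow⟩

/-- An edge enters at most one node. This is read off from a sweep, where it is visible, rather than
from the stages. -/
theorem nodup_ins (hk : 2 ≤ k) (w : ClosedComposition k n) :
    (w.graph.nodes.flatMap Node.ins).Nodup ∧
      ∀ v ∈ w.graph.nodes, ∀ e ∈ v.ins, e < w.graph.numEdges := by
  obtain ⟨u, tr, N, h, hp⟩ := exists_isWord hk w
  have h1 := trace_perm_range h hp
  have h2 := h.ins_perm.trans ((hp.flatMap_right Node.ins).append_left _)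
  have h3 := (h1.symm.trans h2)
  refine ⟨(List.nodup_append.1 (h3.nodup_iff.1 List.nodup_range)).2.1, fun v hv e he => ?_⟩
  rw [← List.mem_range, h3.mem_iff]
  exact List.mem_append_right _ (List.mem_flatMap.2 ⟨v, hv, he⟩)

/-- The labels of the depth-left first search are determined by the graph. -/
theorem IsDepthLeftFirst.unique (hk : 2 ≤ k) (w : ClosedComposition k n) {ℓ ℓ' : ℕ → ℕ}
    (h : w.graph.IsDepthLeftFirst ℓ) (h' : w.graph.IsDepthLeftFirst ℓ') :
    Set.EqOn ℓ' ℓ (Set.Iio w.graph.numEdges) := by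
  obtain ⟨hnd, hins⟩ := nodup_ins hk w
  set E := w.graph.numEdges with hE
  have h00 : 0 < E := by
    rw [← List.mem_range, hE, ← closed_edges w]
    exact List.mem_cons_self
  -- Two searches are compared step by step: once they agree on the labels up to `i`, they have the
  -- same active nodes.
  have key : ∀ i < E, ∀ j ≤ i, ∀ e < E, (ℓ e = j ↔ ℓ' e = j) := by
    intro i
    induction i with
    | zero =>
      intro _ j hj e he
      obtain rfl : j = 0 := by omega
      have h0 : ℓ 0 = 0 := h.2.1 0 (by simp [ClosedComposition.graph, toGraph])
      have h0' : ℓ' 0 = 0 := h'.2.1 0 (by simp [ClosedComposition.graph, toGraph])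
      constructor
      · intro h1
        rw [h.1.injOn (Set.mem_Iio.2 he) (Set.mem_Iio.2 h00) (h1.trans h0.symm), h0']
      · intro h1
        rw [h'.1.injOn (Set.mem_Iio.2 he) (Set.mem_Iio.2 h00) (h1.trans h0'.symm), h0]
    | succ i ih =>
      intro hi j hj e he
      have ih := ih (by omega)
      have hle : ∀ e < E, (ℓ e ≤ i ↔ ℓ' e ≤ i) := by
        intro e he
        constructor
        · intro h1
          exact ((ih _ h1 e he).1 rfl).le.trans h1
        · intro h1
          exact ((ih _ h1 e he).2 rfl).le.trans h1
      have hlt : ∀ e < E, (i < ℓ e ↔ i < ℓ' e) := by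
        intro e he
        rw [← not_le, hle e he, not_le]
      have hact : ∀ v, w.graph.IsActive ℓ i v ↔ w.graph.IsActive ℓ' i v := by
        intro v
        refine and_congr_right fun hv => and_congr ?_ ?_
        · exact forall₂_congr fun e he => hle e (hins v hv e he)
        · refine exists_congr fun e => and_congr_right fun he => ?_
          exact hlt e (lt_numEdges_of_mem_outs w hv he)
      rcases hj.lt_or_eq with hj | rfl
      · exact ih j (by omega) e he
      obtain ⟨v, hv, ⟨a, ha, hmax⟩, x, hx, hxi⟩ := h.2.2 i hi
      obtain ⟨v', hv', ⟨a', ha', hmax'⟩, x', hx', hxi'⟩ := h'.2.2 i hi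
      have h1 := hmax v' ((hact v').2 hv') a' ha'
      have h2 := hmax' v ((hact v).1 hv) a ha
      have haE := hins v hv.1 a ha
      have haE' := hins v' hv'.1 a' ha'
      have h3 : ℓ' a = ℓ a := (ih _ (hv.2.1 a ha) a haE).1 rfl
      have h4 : ℓ a' = ℓ' a' := (ih _ (hv'.2.1 a' ha') a' haE').2 rfl
      -- The inputs `a` and `a'` are maximal for the same labels on the same active nodes, so they
      -- are one edge, and that edge ends in one node.
      have haa : a = a' := h.1.injOn (Set.mem_Iio.2 haE) (Set.mem_Iio.2 haE') (by omega)
      obtain rfl : v = v' := eq_of_mem_of_nodup_flatMap hnd hv.1 hv'.1 ha (haa ▸ ha')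
      have hfind : v.outs.find? (fun y => decide (i < ℓ y)) =
          v.outs.find? (fun y => decide (i < ℓ' y)) := by
        refine List.find?_congr fun y hy => ?_
        rw [decide_eq_decide]
        exact hlt y (lt_numEdges_of_mem_outs w hv.1 hy)
      rw [hfind, hx', Option.some.injEq] at hx
      subst hx
      have hxE := lt_numEdges_of_mem_outs w hv.1 (List.mem_of_find?_eq_some hx')
      constructor
      · intro h5
        rw [h.1.injOn (Set.mem_Iio.2 he) (Set.mem_Iio.2 hxE) (h5.trans hxi.symm), hxi']
      · intro h5
        rw [h'.1.injOn (Set.mem_Iio.2 he) (Set.mem_Iio.2 hxE) (h5.trans hxi'.symm), hxi]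
  intro e he
  exact (key _ (h.1.mapsTo he) _ le_rfl e he).1 rfl

/-- Letter `i` of the word is the row of the edge labelled `i + 1`, and the labelling is unique. -/
theorem IsWord.unique (hk : 2 ≤ k) {w : ClosedComposition k n} {u u' : List ℕ}
    (h : IsWord w u) (h' : IsWord w u') : u = u' := by
  have hlen : u.length = u'.length := by
    have := numEdges_eq_length h
    have := numEdges_eq_length h'
    omega
  obtain ⟨ℓ, hℓ, hr⟩ := h.exists_labelling hk
  obtain ⟨ℓ', hℓ', hr'⟩ := h'.exists_labelling hk
  refine List.ext_getElem hlen fun i hi hi' => ?_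
  obtain ⟨e, he, hei, her⟩ := hr i hi
  obtain ⟨e', he', hei', her'⟩ := hr' i hi'
  have h1 : ℓ' e = ℓ e := IsDepthLeftFirst.unique hk w hℓ hℓ' he
  obtain rfl : e = e' := hℓ'.1.injOn he he' (by omega)
  exact inRow_unique w her her'

theorem IsWord.of_equivalent {w w' : ClosedComposition k n} {u : List ℕ}
    (hw : w.graph.Equivalent w'.graph) (h : IsWord w u) : IsWord w' u := by
  obtain ⟨σ, -, hn, hi, ho⟩ := hw
  obtain ⟨tr, N, h, hp⟩ := h
  refine ⟨tr.map σ, N.map (Node.map σ), ?_, (hp.map _).trans hn⟩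
  have := h.map σ
  rw [ho] at this
  have h0 : List.map σ [0] = [0] := hi
  rwa [h0] at this

/-- Sending the edge visited at each moment in one graph to the edge visited at that moment in the
other is an isomorphism, by `Sweep.map_eq`. -/
theorem IsWord.equivalent {w w' : ClosedComposition k n} {u : List ℕ}
    (h : IsWord w u) (h' : IsWord w' u) : w.graph.Equivalent w'.graph := by
  have hE : w.graph.numEdges = w'.graph.numEdges := by
    rw [numEdges_eq_length h, numEdges_eq_length h']
  obtain ⟨tr, N, h, hp⟩ := h
  obtain ⟨tr', N', h', hp'⟩ := h'
  obtain ⟨τ, hτ, hτl⟩ := exists_perm_eq_getElem (trace_perm_range h hp)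
  obtain ⟨τ', hτ', hτl'⟩ := exists_perm_eq_getElem (trace_perm_range h' hp')
  have hlen : tr.length = tr'.length := by rw [h.length_trace, h'.length_trace]
  have hall : (0 :: tr).map (τ.symm.trans τ') = 0 :: tr' := by
    refine List.ext_getElem (by simp [hlen]) fun i hi hi' => ?_
    rw [List.getElem_map, ← hτl i (by simpa using hi), ← hτl' i hi']
    simp
  rw [List.map_cons, List.cons.injEq] at hall
  obtain ⟨-, h1⟩ := h.map_eq h' rfl rfl hall.2
  obtain ⟨h2, h3⟩ := h1 (by simpa using hall.1)
  refine ⟨τ.symm.trans τ', fun e => ?_, ?_, ?_, h3⟩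
  · rw [Equiv.trans_apply, ← hE]
    rw [hE, hτ', ← hE, ← hτ, Equiv.apply_symm_apply]
  · refine (hp.symm.map _).trans ?_
    rw [h2]
    exact hp'
  · simpa [ClosedComposition.graph, toGraph] using hall.1

end Prograph

namespace Prograph

/-! ### Ballot words -/

/-- The words of rows that are read off from the tableaux of shape `n^3` and density
`(1, k - 1, 1)`. -/
structure IsBallot (k n : ℕ) (u : List ℕ) : Prop where
  lt_three : ∀ x ∈ u, x < 3
  count : ∀ r < 3, u.count r = density₃ k r * n
  count_one_le : ∀ i, (u.take i).count 1 ≤ (k - 1) * (u.take i).count 0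
  count_two_le : ∀ i, (k - 1) * (u.take i).count 2 ≤ (u.take i).count 1

/-! ### Letter counts along a sweep -/

namespace Sweep

variable {k : ℕ} {u L R tr out : List ℕ} {N : List Node}

theorem count_zero (h : Sweep k u L R tr N out) :
    u.count 0 = (N.map Node.op).count .coprod := by
  induction h <;> simp_all

theorem count_two (h : Sweep k u L R tr N out) :
    u.count 2 = (N.map Node.op).count .prod := by
  induction h <;> simp_all

theorem count_one (h : Sweep k u L R tr N out) :
    u.count 1 = R.length + (k - 1) * u.count 0 := by
  induction h with
  | nil => simp
  | coprod e c cs hk h ih =>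
    obtain rfl : k = cs.length + 1 := hk.symm
    simp [mul_add] at ih ⊢
    omega
  | next x h ih =>
    simp at ih ⊢
    omega
  | prod es c hk h ih => simpa using ih

/-- The number of pending strands never becomes negative: each `0` adds `k - 1` of them and each `1`
removes one. -/
theorem count_one_take_le (h : Sweep k u L R tr N out) (i : ℕ) :
    (u.take i).count 1 ≤ R.length + (k - 1) * (u.take i).count 0 := by
  induction h generalizing i with
  | nil => simp
  | coprod e c cs hk h ih =>
    obtain rfl : k = cs.length + 1 := hk.symm
    cases i with
    | zero => simp
    | succ i =>
      have := ih i
      simp [mul_add] at this ⊢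
      omega
  | next x h ih =>
    cases i with
    | zero => simp
    | succ i =>
      have := ih i
      simp at this ⊢
      omega
  | prod es c hk h ih =>
    cases i with
    | zero => simp
    | succ i => simpa using ih i

/-- The number of visited strands stays at least one: a `1` adds one, a `2` replaces `k` by one, and
a `0` changes nothing. -/
theorem count_two_take_lt (h : Sweep k u L R tr N out) (i : ℕ) (hL : 1 ≤ L.length) :
    (k - 1) * (u.take i).count 2 + 1 ≤ L.length + (u.take i).count 1 := by
  induction h generalizing i with
  | nil => simpa using hL
  | coprod e c cs hk h ih =>
    cases i with
    | zero => simp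
    | succ i => simpa using ih i (by simp)
  | next x h ih =>
    cases i with
    | zero => simpa using hL
    | succ i =>
      have := ih i (by simp)
      simp at this ⊢
      omega
  | prod es c hk h ih =>
    subst hk
    cases i with
    | zero => simpa using hL
    | succ i =>
      have := ih i (by simp)
      simp [mul_add] at this hL ⊢
      -- For `k = 0` the truncated difference `k - 1` is `0`, so this case is separate.
      rcases Nat.eq_zero_or_pos es.length with h0 | h0
      · simp [h0] at hL ⊢
        omega
      · omega

end Sweep

theorem drawStage_map_op (k : ℕ) (s : List Op) (xs : List ℕ) (f : ℕ) :
    (drawStage k s xs f).1.map Node.op = s.filter (· ≠ .id) := by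
  induction s generalizing xs f with
  | nil => rfl
  | cons o s ih => cases o <;> simp [drawStage, ih]

theorem draw_map_op (k : ℕ) (w : Composition) (xs : List ℕ) (f : ℕ) :
    (draw k w xs f).1.map Node.op = w.flatten.filter (· ≠ .id) := by
  induction w generalizing xs f with
  | nil => rfl
  | cons s w ih => simp [draw, ih, drawStage_map_op]

variable {k n : ℕ}

theorem IsWord.isBallot {w : ClosedComposition k n} {u : List ℕ} (h : IsWord w u) :
    IsBallot k n u := by
  obtain ⟨tr, N, h, hp⟩ := h
  have hop : (N.map Node.op).Perm (w.1.flatten.filter (· ≠ .id)) :=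
    (hp.map _).trans (.of_eq (draw_map_op k w.1 [0] 1))
  have h0 : u.count 0 = n := by
    rw [h.count_zero, hop.count_eq, List.count_filter (by decide), w.2.2.1]
  have h2 : u.count 2 = n := by
    rw [h.count_two, hop.count_eq, List.count_filter (by decide), w.2.2.2]
  have h1 : u.count 1 = (k - 1) * n := by simpa [h0] using h.count_one
  refine ⟨h.lt_three, fun r hr => ?_, fun i => by simpa using h.count_one_take_le i, fun i => ?_⟩
  · interval_cases r <;> simp [density₃, h0, h1, h2]
  · have := h.count_two_take_lt i (by simp)
    simp at this
    omega

/-! ### From ballot words to compositions -/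

theorem drawStage_replicate_id_append (k m : ℕ) (s : List Op) (p xs : List ℕ) (f : ℕ)
    (hp : p.length = m) :
    drawStage k (List.replicate m .id ++ s) (p ++ xs) f =
      ((drawStage k s xs f).1, p ++ (drawStage k s xs f).2.1, (drawStage k s xs f).2.2) := by
  induction m generalizing p with
  | zero =>
    obtain rfl := List.length_eq_zero_iff.1 hp
    simp
  | succ m ih =>
    obtain ⟨x, p, rfl⟩ : ∃ x p', p = x :: p' :=
      List.exists_cons_of_ne_nil (by rintro rfl; simp at hp)
    have := ih p (by simpa using hp)
    simp [List.replicate_succ, drawStage, this]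

theorem drawStage_replicate_id (k m : ℕ) (xs : List ℕ) (f : ℕ) (hp : xs.length = m) :
    drawStage k (List.replicate m .id) xs f = ([], xs, f) := by
  simpa [drawStage] using drawStage_replicate_id_append k m [] xs [] f hp

/-- The state is the number `l` of visited and `r` of pending strands, with `d = k - 1`. A letter
`0` or `2` becomes a stage with a single operator ending at the last visited strand and identities
elsewhere; a letter `1` adds no stage and only moves the border. The prefix inequalities say that
the required strands exist, and the equalities that one strand is left. -/
theorem exists_composition {d : ℕ} (u : List ℕ) (l r : ℕ) (hl : 1 ≤ l)
    (hu : ∀ x ∈ u, x < 3)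
    (h1 : ∀ i, (u.take i).count 1 ≤ r + d * (u.take i).count 0)
    (h2 : ∀ i, d * (u.take i).count 2 + 1 ≤ l + (u.take i).count 1)
    (h1' : u.count 1 = r + d * u.count 0) (h2' : d * u.count 2 + 1 = l + u.count 1) :
    ∃ w : Composition, IsComposable (d + 1) (l + r) w 1 ∧
      w.flatten.count .coprod = u.count 0 ∧ w.flatten.count .prod = u.count 2 ∧
      ∀ (L R : List ℕ) (f : ℕ), L.length = l → R.length = r →
        ∃ tr, Sweep (d + 1) u L R tr (draw (d + 1) w (L.reverse ++ R) f).1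
          (draw (d + 1) w (L.reverse ++ R) f).2.1 := by
  induction u generalizing l r with
  | nil =>
    simp at h1' h2'
    subst h1'
    refine ⟨[], by simp [IsComposable, h2'], by simp, by simp, fun L R f hL hR => ⟨[], ?_⟩⟩
    obtain rfl := List.length_eq_zero_iff.1 hR
    simpa [draw] using Sweep.nil L
  | cons a u ih =>
    have ha := hu a List.mem_cons_self
    have hu' : ∀ x ∈ u, x < 3 := fun x hx => hu x (List.mem_cons_of_mem _ hx)
    have h1s : ∀ i, _ := fun i => h1 (i + 1)
    have h2s : ∀ i, _ := fun i => h2 (i + 1)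
    simp only [List.take_succ_cons] at h1s h2s
    interval_cases a
    · simp [mul_add] at h1s h2s h1' h2'
      obtain ⟨w, hw, hc, hc', hs⟩ := ih l (d + r) hl hu' (fun i => by have := h1s i; omega) h2s
        (by omega) h2'
      obtain ⟨l, rfl⟩ : ∃ l', l = l' + 1 := ⟨l - 1, by omega⟩
      refine ⟨(List.replicate l .id ++ .coprod :: List.replicate r .id) :: w, ?_, ?_, ?_, ?_⟩
      · refine ⟨by simp [Op.arity]; omega, ?_⟩
        convert hw using 1
        simp [Op.coarity]
        omega
      · simp [hc, List.count_replicate]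
      · simp [hc', List.count_replicate]
      · intro L R f hL hR
        obtain ⟨e, L, rfl⟩ : ∃ x p', L = x :: p' :=
          List.exists_cons_of_ne_nil (by rintro rfl; simp at hL)
        obtain ⟨tr, hs⟩ := hs (f :: L) (List.range' (f + 1) d ++ R) (f + (d + 1))
          (by simpa using hL) (by simp [hR])
        refine ⟨f :: tr, ?_⟩
        have hst : drawStage (d + 1) (List.replicate l .id ++ .coprod :: List.replicate r .id)
            ((e :: L).reverse ++ R) f = ([⟨.coprod, [e], f :: List.range' (f + 1) d⟩],
              (f :: L).reverse ++ (List.range' (f + 1) d ++ R), f + (d + 1)) := by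
          have := drawStage_replicate_id_append (d + 1) l (.coprod :: List.replicate r .id)
            L.reverse (e :: R) f (by simpa using hL)
          simpa [drawStage, drawStage_replicate_id _ _ _ _ hR, List.range'_succ] using this
        simp only [draw, hst]
        exact .coprod e f _ (by simp) hs
    · simp at h1s h2s h1' h2'
      have := h1s 0
      -- The inequality for the prefix of length one provides a pending strand.
      obtain ⟨r, rfl⟩ : ∃ r', r = r' + 1 := ⟨r - 1, by simp at this; omega⟩
      obtain ⟨w, hw, hc, hc', hs⟩ := ih (l + 1) r (by omega) hu'
        (fun i => by have := h1s i; omega) (fun i => by have := h2s i; omega)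
        (by omega) (by omega)
      refine ⟨w, ?_, by simpa using hc, by simpa using hc', ?_⟩
      · convert hw using 1
        omega
      · intro L R f hL hR
        obtain ⟨x, R, rfl⟩ : ∃ x p', R = x :: p' :=
          List.exists_cons_of_ne_nil (by rintro rfl; simp at hR)
        obtain ⟨tr, hs⟩ := hs (x :: L) R f (by simpa using hL) (by simpa using hR)
        exact ⟨_, .next x (by simpa using hs)⟩
    · simp [mul_add] at h1s h2s h1' h2'
      have := h2s 0
      -- The inequality for the prefix of length one provides the `d + 1` visited strands that the
      -- product absorbs.
      obtain ⟨l, rfl⟩ : ∃ l', l = l' + (d + 1) := ⟨l - (d + 1), by simp at this; omega⟩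
      obtain ⟨w, hw, hc, hc', hs⟩ := ih (l + 1) r (by omega) hu'
        h1s (fun i => by have := h2s i; omega) (by omega) (by omega)
      refine ⟨(List.replicate l .id ++ .prod :: List.replicate r .id) :: w, ?_, ?_, ?_, ?_⟩
      · refine ⟨by simp [Op.arity]; omega, ?_⟩
        convert hw using 1
        simp [Op.coarity]
        omega
      · simp [hc, List.count_replicate]
      · simp [hc', List.count_replicate]
      · intro L R f hL hR
        obtain ⟨es, L, rfl, hes⟩ : ∃ es L', L = es.reverse ++ L' ∧ es.length = d + 1 :=
          ⟨(L.take (d + 1)).reverse, L.drop (d + 1), by simp, by simp; omega⟩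
        simp [hes] at hL
        have hL : L.length = l := by omega
        obtain ⟨tr, hs⟩ := hs (f :: L) R (f + 1) (by simpa using hL) hR
        refine ⟨f :: tr, ?_⟩
        have hst : drawStage (d + 1) (List.replicate l .id ++ .prod :: List.replicate r .id)
            ((es.reverse ++ L).reverse ++ R) f =
              ([⟨.prod, es, [f]⟩], (f :: L).reverse ++ R, f + 1) := by
          have := drawStage_replicate_id_append (d + 1) l (.prod :: List.replicate r .id)
            L.reverse (es ++ R) f (by simpa using hL)
          have htake : (es ++ R).take (d + 1) = es := by rw [← hes, List.take_left]
          have hdrop : (es ++ R).drop (d + 1) = R := by rw [← hes, List.drop_left]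
          simpa [drawStage, drawStage_replicate_id _ _ _ _ hR, htake, hdrop] using this
        simp only [draw, hst]
        exact .prod es f hes hs

theorem IsBallot.exists_isWord (hk : 2 ≤ k) {u : List ℕ} (h : IsBallot k n u) :
    ∃ w : ClosedComposition k n, IsWord w u := by
  obtain ⟨d, rfl⟩ : ∃ d, k = d + 1 := ⟨k - 1, by omega⟩
  have h0 := h.count 0 (by simp)
  have h1 := h.count 1 (by simp)
  have h2 := h.count 2 (by simp)
  simp only [density₃, one_mul, Nat.add_sub_cancel] at h0 h1 h2
  obtain ⟨w, hw, hc, hc', hs⟩ := exists_composition (d := d) u 1 0 le_rfl h.lt_three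
    (fun i => by simpa using h.count_one_le i)
    (fun i => by have := h.count_two_le i; simp at this; omega)
    (by rw [h0, h1, zero_add]) (by rw [h1, h2, add_comm])
  obtain ⟨tr, hs⟩ := hs [0] [] 1 rfl rfl
  exact ⟨⟨w, hw, by rw [hc, h0], by rw [hc', h2]⟩, tr, _, hs, .refl _⟩

end Prograph

namespace Prograph

/-! ### Ballot words and tableaux -/

theorem card_filter_getElem? {α : Type*} [DecidableEq α] (u : List α) (r : α) (i : ℕ) :
    ((Finset.range i).filter (fun p => u[p]? = some r)).card = (u.take i).count r := by
  induction i with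
  | zero => simp
  | succ i ih =>
    rw [Finset.range_add_one, Finset.filter_insert, List.take_add_one, List.count_append, ← ih]
    split_ifs with h
    · rw [Finset.card_insert_of_notMem (by simp)]
      simp [h]
    · cases hu : u[i]? with
      | none => simp
      | some x =>
        have : x ≠ r := fun hx => h (by rw [hu, hx])
        simp [this]

theorem count_take_mono {α : Type*} [DecidableEq α] (u : List α) (r : α) {i j : ℕ} (h : i ≤ j) :
    (u.take i).count r ≤ (u.take j).count r :=
  (List.take_sublist_take_left h).count_le r

theorem count_take_succ {α : Type*} [DecidableEq α] {u : List α} {r : α} {i : ℕ}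
    (h : u[i]? = some r) : (u.take (i + 1)).count r = (u.take i).count r + 1 := by
  simp [List.take_add_one, h]

theorem exists_count_take_eq {α : Type*} [DecidableEq α] (u : List α) (r : α) {v : ℕ}
    (hv : v < u.count r) : ∃ p, u[p]? = some r ∧ (u.take p).count r = v := by
  induction u generalizing v with
  | nil => simp at hv
  | cons x u ih =>
    by_cases hx : x = r
    · subst hx
      cases v with
      | zero => exact ⟨0, by simp, by simp⟩
      | succ v =>
        obtain ⟨p, hp, hp'⟩ := ih (v := v) (by simpa using hv)
        exact ⟨p + 1, by simpa using hp, by simpa using hp'⟩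
    · obtain ⟨p, hp, hp'⟩ := ih (v := v) (by simpa [List.count_cons, hx] using hv)
      exact ⟨p + 1, by simpa using hp, by simpa [List.count_cons, hx] using hp'⟩

theorem mem_rectDiagram {m n : ℕ} {c : ℕ × ℕ} : c ∈ rectDiagram m n ↔ c.1 < m ∧ c.2 < n := by
  rw [← YoungDiagram.mem_cells]
  simp [rectDiagram]

theorem density₃_pos {k r : ℕ} (hk : 2 ≤ k) (hr : r < 3) : 0 < density₃ k r := by
  interval_cases r <;> simp [density₃]
  omega

theorem sum_density₃ {k : ℕ} (hk : 2 ≤ k) (n : ℕ) :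
    ∑ c ∈ (rectDiagram 3 n).cells, density₃ k c.1 = (k + 1) * n := by
  obtain ⟨d, rfl⟩ : ∃ d, k = d + 1 := ⟨k - 1, by omega⟩
  simp [rectDiagram, Finset.sum_product, Finset.sum_range_succ, density₃]
  ring

theorem length_eq_sum_count {u : List ℕ} (h : ∀ x ∈ u, x < 3) :
    u.length = u.count 0 + u.count 1 + u.count 2 := by
  induction u with
  | nil => rfl
  | cons x u ih =>
    have hx := h x List.mem_cons_self
    have := ih fun y hy => h y (List.mem_cons_of_mem _ hy)
    interval_cases x <;> simp [this] <;> omega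

variable {k n : ℕ}

theorem IsBallot.length_eq (hk : 2 ≤ k) {u : List ℕ} (h : IsBallot k n u) :
    u.length = (k + 1) * n := by
  rw [length_eq_sum_count h.lt_three, h.count 0 (by simp), h.count 1 (by simp),
    h.count 2 (by simp)]
  obtain ⟨d, rfl⟩ : ∃ d, k = d + 1 := ⟨k - 1, by omega⟩
  simp only [density₃, Nat.add_sub_cancel]
  ring

/-- The index type of the entries of a tableau. -/
abbrev Entry (k n : ℕ) : Type :=
  Finset.Icc 1 (∑ c ∈ (rectDiagram 3 n).cells, density₃ k c.1)

theorem Entry.pos (a : Entry k n) : 1 ≤ (a : ℕ) := (Finset.mem_Icc.1 a.2).1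

theorem Entry.le (hk : 2 ≤ k) (a : Entry k n) : (a : ℕ) ≤ (k + 1) * n :=
  sum_density₃ hk n ▸ (Finset.mem_Icc.1 a.2).2

theorem Entry.exists_eq (hk : 2 ≤ k) {i : ℕ} (hi : i < (k + 1) * n) :
    ∃ a : Entry k n, (a : ℕ) = i + 1 :=
  ⟨⟨i + 1, by rw [sum_density₃ hk]; simp; omega⟩, rfl⟩

/-- The filling of the rectangle that corresponds to a word of rows. -/
def cellOfWord (k : ℕ) (u : List ℕ) (a : ℕ) : ℕ × ℕ :=
  (u.getD (a - 1) 0,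
    (u.take (a - 1)).count (u.getD (a - 1) 0) / density₃ k (u.getD (a - 1) 0))

theorem IsBallot.getElem?_eq (hk : 2 ≤ k) {u : List ℕ} (h : IsBallot k n u) (a : Entry k n) :
    u[(a : ℕ) - 1]? = some (u.getD ((a : ℕ) - 1) 0) := by
  have := h.length_eq hk
  have := Entry.le hk a
  have := Entry.pos a
  rw [List.getD_eq_getElem _ _ (by omega), List.getElem?_eq_getElem]

/-- With ρ = `density₃ k r`, the cell `(r, j)` holds the occurrences of the letter `r` numbered from
jρ to (j+1)ρ - 1, counted from zero. -/
theorem IsBallot.cellOfWord_eq_iff (hk : 2 ≤ k) {u : List ℕ} (h : IsBallot k n u)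
    (a : Entry k n) (r j : ℕ) :
    cellOfWord k u a = (r, j) ↔ u[(a : ℕ) - 1]? = some r ∧
      j * density₃ k r ≤ (u.take ((a : ℕ) - 1)).count r ∧
      (u.take ((a : ℕ) - 1)).count r < (j + 1) * density₃ k r := by
  have hget := h.getElem?_eq hk a
  have hlt := h.lt_three _ (List.mem_of_getElem? hget)
  simp only [cellOfWord, Prod.mk.injEq, hget, Option.some.injEq]
  refine and_congr_right fun hr => ?_
  rw [hr] at hlt ⊢
  have hpos := density₃_pos hk hlt
  rw [← Nat.le_div_iff_mul_le hpos, ← Nat.div_lt_iff_lt_mul hpos]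
  omega

theorem IsBallot.row_standard (hk : 2 ≤ k) {u : List ℕ} (h : IsBallot k n u)
    (a b : Entry k n) (i j : ℕ) (ha : cellOfWord k u a = (i, j))
    (hb : cellOfWord k u b = (i, j + 1)) : a < b := by
  rw [h.cellOfWord_eq_iff hk] at ha hb
  by_contra hab
  have hab : (b : ℕ) ≤ a := not_lt.1 hab
  have := count_take_mono u i (Nat.sub_le_sub_right hab 1)
  omega

theorem IsBallot.column_standard (hk : 2 ≤ k) {u : List ℕ} (h : IsBallot k n u)
    (a b : Entry k n) (i j : ℕ) (ha : cellOfWord k u a = (i, j))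
    (hb : cellOfWord k u b = (i + 1, j)) : a < b := by
  rw [h.cellOfWord_eq_iff hk] at ha hb
  by_contra hab
  have hab : (b : ℕ) ≤ a := not_lt.1 hab
  have hne : (b : ℕ) ≠ a := by
    intro heq
    have h1 := ha.1
    rw [← heq, hb.1, Option.some.injEq] at h1
    omega
  have hpa := Entry.pos a
  have hpb := Entry.pos b
  have hi : i + 1 < 3 := h.lt_three _ (List.mem_of_getElem? hb.1)
  have hmono := count_take_mono u i (show (b : ℕ) - 1 + 1 ≤ (a : ℕ) - 1 by omega)
  have hsucc := count_take_succ hb.1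
  obtain ⟨-, h1, h2⟩ := ha
  obtain ⟨-, h3, h4⟩ := hb
  -- Assume `b` precedes `a`. In the upper case the prefix through `b` has more than `(k - 1) * j`
  -- ones but at most `j` zeros; in the lower case it has at least `j + 1` twos but fewer than `(k -
  -- 1) * (j + 1)` ones. Each contradicts a ballot inequality.
  obtain rfl | rfl : i = 0 ∨ i = 1 := by omega
  · have h5 := h.count_one_le ((b : ℕ) - 1 + 1)
    simp only [density₃, zero_add] at h1 h2 h3 h4 hsucc
    have h6 : (k - 1) * (u.take ((b : ℕ) - 1 + 1)).count 0 ≤ (k - 1) * j :=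
      Nat.mul_le_mul_left _ (by omega)
    have h7 : j * (k - 1) = (k - 1) * j := mul_comm _ _
    omega
  · have h5 := h.count_two_le ((b : ℕ) - 1 + 1)
    simp only [density₃, Nat.reduceAdd] at h1 h2 h3 h4 hsucc
    have h6 : (k - 1) * (j + 1) ≤ (k - 1) * (u.take ((b : ℕ) - 1 + 1)).count 2 :=
      Nat.mul_le_mul_left _ (by omega)
    have h7 : (j + 1) * (k - 1) = (k - 1) * (j + 1) := mul_comm _ _
    omega

/-- The tableau of a ballot word. -/
def IsBallot.toTableau (hk : 2 ≤ k) {u : List ℕ} (h : IsBallot k n u) :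
    SetValuedSYT (rectDiagram 3 n) (density₃ k) where
  cell a := cellOfWord k u a
  mem_shape a := by
    rcases hc : cellOfWord k u a with ⟨r, j⟩
    obtain ⟨h1, h2, -⟩ := (h.cellOfWord_eq_iff hk a r j).1 hc
    have hlt := h.lt_three _ (List.mem_of_getElem? h1)
    refine mem_rectDiagram.2 ⟨hlt, show j < n from ?_⟩
    have h3 := count_take_succ h1
    have h4 : (u.take ((a : ℕ) - 1 + 1)).count r ≤ u.count r :=
      (List.take_sublist _ _).count_le r
    rw [h.count r hlt, mul_comm] at h4
    exact Nat.lt_of_mul_lt_mul_right (a := density₃ k r) (by omega)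
  density := by
    rintro ⟨r, j⟩ hc
    obtain ⟨hr, hj⟩ := mem_rectDiagram.1 hc
    simp only at hr hj
    have hI : (Set.Ico (j * density₃ k r) ((j + 1) * density₃ k r)).ncard = density₃ k r := by
      rw [Set.ncard_eq_toFinset_card', Set.toFinset_Ico, Nat.card_Ico, add_mul]
      simp
    simp only
    rw [← hI]
    -- Numbering the occurrences of `r` matches the entries of the cell with an interval of length
    -- `density₃ k r`.
    refine Set.ncard_congr (fun a _ => (u.take ((a : ℕ) - 1)).count r) ?_ ?_ ?_
    · intro a ha
      exact ((h.cellOfWord_eq_iff hk a r j).1 ha).2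
    · intro a b ha hb hab
      have ha := ((h.cellOfWord_eq_iff hk a r j).1 ha).1
      have hb := ((h.cellOfWord_eq_iff hk b r j).1 hb).1
      have hpa := Entry.pos a
      have hpb := Entry.pos b
      have h1 := count_take_succ ha
      have h2 := count_take_succ hb
      refine Subtype.ext ?_
      rcases lt_trichotomy (a : ℕ) b with hlt | heq | hlt
      · have := count_take_mono u r (show (a : ℕ) - 1 + 1 ≤ (b : ℕ) - 1 by omega)
        omega
      · exact heq
      · have := count_take_mono u r (show (b : ℕ) - 1 + 1 ≤ (a : ℕ) - 1 by omega)
        omega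
    · rintro v ⟨hv, hv'⟩
      have hcount : v < u.count r := by
        rw [h.count r hr, mul_comm]
        exact hv'.trans_le (Nat.mul_le_mul_right _ hj)
      obtain ⟨p, hp, hp'⟩ := exists_count_take_eq u r hcount
      have hlen := (List.getElem?_eq_some_iff.1 hp).1
      obtain ⟨a, ha⟩ := Entry.exists_eq hk (h.length_eq hk ▸ hlen)
      have hpa : p = (a : ℕ) - 1 := by omega
      subst hpa
      exact ⟨a, (h.cellOfWord_eq_iff hk a r j).2 ⟨hp, by omega, by omega⟩, hp'⟩
  row_standard := h.row_standard hk
  column_standard := h.column_standard hk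

theorem IsBallot.eq_of_toTableau_eq (hk : 2 ≤ k) {u u' : List ℕ} (h : IsBallot k n u)
    (h' : IsBallot k n u') (heq : h.toTableau hk = h'.toTableau hk) : u = u' := by
  have hlen := h.length_eq hk
  have hlen' := h'.length_eq hk
  refine List.ext_getElem (by omega) fun i hi hi' => ?_
  obtain ⟨a, ha⟩ := Entry.exists_eq hk (hlen ▸ hi)
  have h1 : (h.toTableau hk).cell a = (h'.toTableau hk).cell a := by rw [heq]
  have h2 := congrArg Prod.fst h1
  simpa [IsBallot.toTableau, cellOfWord, ha, hi, hi'] using h2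

/-! ### From a tableau back to its word -/

section Tableau

variable (T : SetValuedSYT (rectDiagram 3 n) (density₃ k))

theorem tableau_card_cell {c : ℕ × ℕ} (h1 : c.1 < 3) (h2 : c.2 < n) :
    (Finset.univ.filter (fun a => T.cell a = c)).card = density₃ k c.1 := by
  rw [← T.density c (mem_rectDiagram.2 ⟨h1, h2⟩), Set.ncard_eq_toFinset_card']
  congr 1
  ext a
  simp

theorem tableau_exists_cell (hk : 2 ≤ k) {c : ℕ × ℕ} (h1 : c.1 < 3) (h2 : c.2 < n) :
    ∃ a, T.cell a = c := by
  have h := tableau_card_cell T h1 h2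
  have hpos : 0 < (Finset.univ.filter (fun a => T.cell a = c)).card := by
    rw [h]
    exact density₃_pos hk h1
  obtain ⟨a, ha⟩ := Finset.card_pos.1 hpos
  exact ⟨a, by simpa using ha⟩

/-- The chain of adjacent cells between the two never breaks, since positive density leaves no cell
empty. -/
theorem tableau_row_lt (hk : 2 ≤ k) {a b : Entry k n} (h : (T.cell a).1 = (T.cell b).1)
    (hlt : (T.cell a).2 < (T.cell b).2) : a < b := by
  obtain ⟨m, hm⟩ := Nat.exists_eq_add_of_lt hlt
  induction m generalizing b with
  | zero => exact T.row_standard a b _ _ rfl (Prod.ext h.symm hm)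
  | succ m ih =>
    obtain ⟨h1, h2⟩ := mem_rectDiagram.1 (T.mem_shape b)
    obtain ⟨c, hc⟩ := tableau_exists_cell T hk (c := ((T.cell b).1, (T.cell a).2 + m + 1)) h1
      (by simp only; omega)
    refine (ih (b := c) (by rw [hc, h]) (by rw [hc]; simp only; omega) (by rw [hc])).trans ?_
    exact T.row_standard c b _ _ hc (Prod.ext rfl (by simp only; omega))

theorem tableau_card_columns_lt {r m : ℕ} (hr : r < 3) (hm : m ≤ n) :
    (Finset.univ.filter (fun a => (T.cell a).1 = r ∧ (T.cell a).2 < m)).card =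
      m * density₃ k r := by
  rw [Finset.card_eq_sum_card_fiberwise (f := fun a => (T.cell a).2) (t := Finset.range m)
    (fun a ha => by simpa using (Finset.mem_filter.1 ha).2.2)]
  rw [Finset.sum_congr rfl (g := fun _ => density₃ k r), Finset.sum_const, Finset.card_range,
    smul_eq_mul]
  intro j hj
  rw [Finset.mem_range] at hj
  rw [← tableau_card_cell T (c := (r, j)) hr (by simp only; omega), Finset.filter_filter]
  congr 1
  ext a
  simp only [Finset.mem_filter, Finset.mem_univ, true_and, Prod.ext_iff]
  constructor
  · rintro ⟨⟨h1, -⟩, h2⟩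
    exact ⟨h1, h2⟩
  · rintro ⟨h1, h2⟩
    exact ⟨⟨h1, by omega⟩, h2⟩

/-- Let `a` lie in column j of a row of density ρ. The jρ entries of earlier columns are smaller
than `a`, and all smaller entries of the row lie in the first j+1 columns, which also contain `a`.
So their number is at least jρ and less than (j+1)ρ. -/
theorem tableau_column_eq (hk : 2 ≤ k) (a : Entry k n) :
    (T.cell a).2 = (Finset.univ.filter (fun b => (T.cell b).1 = (T.cell a).1 ∧ b < a)).card /
      density₃ k (T.cell a).1 := by
  obtain ⟨hr, hj⟩ := mem_rectDiagram.1 (T.mem_shape a)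
  have h1 := tableau_card_columns_lt T hr hj.le
  have h2 := tableau_card_columns_lt T hr (Nat.succ_le_of_lt hj)
  have hpos := density₃_pos hk hr
  symm
  have hle : (Finset.univ.filter
        (fun b => (T.cell b).1 = (T.cell a).1 ∧ (T.cell b).2 < (T.cell a).2)).card ≤
      (Finset.univ.filter (fun b => (T.cell b).1 = (T.cell a).1 ∧ b < a)).card := by
    refine Finset.card_le_card fun b hb => ?_
    simp only [Finset.mem_filter, Finset.mem_univ, true_and] at hb ⊢
    exact ⟨hb.1, tableau_row_lt T hk hb.1 hb.2⟩
  have hlt : (Finset.univ.filter (fun b => (T.cell b).1 = (T.cell a).1 ∧ b < a)).card <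
      (Finset.univ.filter
        (fun b => (T.cell b).1 = (T.cell a).1 ∧ (T.cell b).2 < (T.cell a).2.succ)).card := by
    refine Finset.card_lt_card (Finset.ssubset_iff_of_subset ?_ |>.2 ⟨a, by simp, by simp⟩)
    intro b hb
    simp only [Finset.mem_filter, Finset.mem_univ, true_and] at hb ⊢
    refine ⟨hb.1, Nat.lt_succ_of_le (not_lt.1 fun hlt => ?_)⟩
    exact lt_asymm hb.2 (tableau_row_lt T hk hb.1.symm hlt)
  have h3 := (Nat.le_div_iff_mul_le hpos).2 (h1 ▸ hle)
  have h4 := (Nat.div_lt_iff_lt_mul hpos).2 (h2 ▸ hlt)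
  omega

/-- The rows of the entries of a tableau. -/
def rowWord : List ℕ :=
  List.ofFn fun i : Fin (∑ c ∈ (rectDiagram 3 n).cells, density₃ k c.1) =>
    (T.cell ⟨i + 1, Finset.mem_Icc.2 ⟨by omega, i.2⟩⟩).1

theorem length_rowWord (hk : 2 ≤ k) : (rowWord T).length = (k + 1) * n := by
  rw [rowWord, List.length_ofFn, sum_density₃ hk]

theorem rowWord_getElem? (a : Entry k n) : (rowWord T)[(a : ℕ) - 1]? = some (T.cell a).1 := by
  have h := Finset.mem_Icc.1 a.2
  have hlt : (a : ℕ) - 1 < ∑ c ∈ (rectDiagram 3 n).cells, density₃ k c.1 := by omega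
  rw [rowWord, List.getElem?_ofFn, dif_pos hlt]
  congr 3
  exact Subtype.ext (by simp only; omega)

theorem count_take_rowWord (hk : 2 ≤ k) (i r : ℕ) :
    ((rowWord T).take i).count r =
      (Finset.univ.filter (fun a => (T.cell a).1 = r ∧ (a : ℕ) ≤ i)).card := by
  rw [← card_filter_getElem?]
  symm
  refine Finset.card_bij (fun a _ => (a : ℕ) - 1) ?_ ?_ ?_
  · intro a ha
    have hpos := Entry.pos a
    simp only [Finset.mem_filter, Finset.mem_univ, true_and] at ha
    simp only [Finset.mem_filter, Finset.mem_range, rowWord_getElem?, ha.1, and_true]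
    omega
  · intro a _ b _ hab
    have hpa := Entry.pos a
    have hpb := Entry.pos b
    exact Subtype.ext (by omega)
  · intro p hp
    simp only [Finset.mem_filter, Finset.mem_range] at hp
    have hlen := (List.getElem?_eq_some_iff.1 hp.2).1
    obtain ⟨a, ha⟩ := Entry.exists_eq hk (length_rowWord T hk ▸ hlen)
    have hpa : p = (a : ℕ) - 1 := by omega
    subst hpa
    have h1 := hp.2
    rw [rowWord_getElem?, Option.some.injEq] at h1
    exact ⟨a, by simp [h1]; omega, rfl⟩

theorem isBallot_rowWord (hk : 2 ≤ k) : IsBallot k n (rowWord T) where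
  lt_three := by
    intro x hx
    simp only [rowWord, List.mem_ofFn] at hx
    obtain ⟨i, rfl⟩ := hx
    exact (mem_rectDiagram.1 (T.mem_shape _)).1
  count := by
    intro r hr
    have h1 := tableau_card_columns_lt T hr le_rfl
    rw [mul_comm, ← h1, ← List.take_length (l := rowWord T), count_take_rowWord T hk]
    congr 1
    ext a
    have h2 := Entry.le hk a
    have h3 := (mem_rectDiagram.1 (T.mem_shape a)).2
    simp [length_rowWord T hk, h2, h3]
  count_one_le := by
    intro i
    rw [count_take_rowWord T hk, count_take_rowWord T hk]
    set X := Finset.univ.filter (fun a => (T.cell a).1 = 1 ∧ (a : ℕ) ≤ i) with hX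
    set Y := Finset.univ.filter (fun a => (T.cell a).1 = 0 ∧ (a : ℕ) ≤ i) with hY
    -- The column of each middle entry up to `i` has a smaller top entry, and no column has more
    -- than `k - 1` middle entries.
    have hmap : ∀ a ∈ X, (T.cell a).2 ∈ Y.image (fun a => (T.cell a).2) := by
      intro a ha
      simp only [hX, Finset.mem_filter, Finset.mem_univ, true_and] at ha
      obtain ⟨b, hb⟩ := tableau_exists_cell T hk (c := (0, (T.cell a).2)) (by simp)
        (mem_rectDiagram.1 (T.mem_shape a)).2
      have hlt : (b : ℕ) < a := T.column_standard b a 0 (T.cell a).2 hb (Prod.ext ha.1 rfl)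
      exact Finset.mem_image.2 ⟨b, by simp [hY, hb]; omega, by simp [hb]⟩
    refine (Finset.card_le_mul_card_image_of_maps_to hmap (k - 1) ?_).trans
      (Nat.mul_le_mul_left _ Finset.card_image_le)
    intro j hj
    obtain ⟨b, -, rfl⟩ := Finset.mem_image.1 hj
    have hcard := tableau_card_cell T (c := (1, (T.cell b).2)) (by simp)
      (mem_rectDiagram.1 (T.mem_shape b)).2
    refine le_trans (Finset.card_le_card fun a ha => ?_) hcard.le
    simp only [hX, Finset.mem_filter, Finset.mem_univ, true_and] at ha ⊢
    exact Prod.ext ha.1.1 ha.2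
  count_two_le := by
    intro i
    rw [count_take_rowWord T hk, count_take_rowWord T hk]
    set X := Finset.univ.filter (fun a => (T.cell a).1 = 2 ∧ (a : ℕ) ≤ i) with hX
    set Y := Finset.univ.filter (fun a => (T.cell a).1 = 1 ∧ (a : ℕ) ≤ i) with hY
    -- Bottom cells hold one entry each, so the bottom entries up to `i` lie in distinct columns. In
    -- each of these columns all `k - 1` middle entries are smaller, and `Z` collects them.
    have hinj : Set.InjOn (fun a => (T.cell a).2) (X : Set (Entry k n)) := by
      intro a ha b hb hab
      simp only [hX, Finset.coe_filter, Finset.mem_univ, true_and, Set.mem_ofPred_eq] at ha hb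
      have hcard := tableau_card_cell T (c := (2, (T.cell b).2)) (by simp)
        (mem_rectDiagram.1 (T.mem_shape b)).2
      refine Finset.card_le_one.1 hcard.le a ?_ b ?_ <;>
        simp only [Finset.mem_filter, Finset.mem_univ, true_and]
      · exact Prod.ext ha.1 hab
      · exact Prod.ext hb.1 rfl
    rw [← Finset.card_image_of_injOn hinj]
    set Z := Y.filter (fun a => (T.cell a).2 ∈ X.image (fun a => (T.cell a).2)) with hZ
    refine le_trans ?_ (Finset.card_le_card (Finset.filter_subset _ _) : Z.card ≤ Y.card)
    rw [Finset.card_eq_sum_card_fiberwise (s := Z) (f := fun a => (T.cell a).2)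
      (t := X.image (fun a => (T.cell a).2)) (fun a ha => (Finset.mem_filter.1 ha).2), mul_comm,
      ← smul_eq_mul]
    refine Finset.card_nsmul_le_sum _ _ _ fun j hj => ?_
    obtain ⟨b, hb, rfl⟩ := Finset.mem_image.1 hj
    simp only [hX, Finset.mem_filter, Finset.mem_univ, true_and] at hb
    have hcard := tableau_card_cell T (c := (1, (T.cell b).2)) (by simp)
      (mem_rectDiagram.1 (T.mem_shape b)).2
    refine le_trans hcard.ge (Finset.card_le_card fun a ha => ?_)
    simp only [Finset.mem_filter, Finset.mem_univ, true_and] at ha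
    have hlt : (a : ℕ) < b := T.column_standard a b 1 (T.cell b).2 ha (Prod.ext hb.1 rfl)
    simp only [hZ, hY, Finset.mem_filter, Finset.mem_univ, true_and, ha, and_true]
    exact ⟨by omega, hj⟩

theorem toTableau_rowWord (hk : 2 ≤ k) : (isBallot_rowWord T hk).toTableau hk = T := by
  refine SetValuedSYT.ext (funext fun a => ?_)
  have h1 := rowWord_getElem? T a
  have h2 : (rowWord T).getD ((a : ℕ) - 1) 0 = (T.cell a).1 := by
    rw [List.getD_eq_getElem?_getD, h1, Option.getD_some]
  have hpos := Entry.pos a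
  refine Prod.ext h2 ?_
  rw [tableau_column_eq T hk a]
  simp only [IsBallot.toTableau, cellOfWord, h2]
  rw [count_take_rowWord T hk]
  congr 2
  ext b
  simp only [Finset.mem_filter, Finset.mem_univ, true_and]
  refine and_congr_right fun _ => ?_
  rw [← Subtype.coe_lt_coe]
  omega

end Tableau

end Prograph

namespace Prograph

/-! ### The tableau of a closed composition -/

variable {k n : ℕ}

theorem IsWord.isTableauOf (hk : 2 ≤ k) {w : ClosedComposition k n} {u : List ℕ}
    (h : IsWord w u) {ℓ : ℕ → ℕ} (hℓ : w.graph.IsDepthLeftFirst ℓ) :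
    IsTableauOf (h.isBallot.toTableau hk) w.graph ℓ := by
  obtain ⟨ℓ₀, hℓ₀, hrow₀⟩ := h.exists_labelling hk
  have hE := numEdges_eq_length h
  have hlen := h.isBallot.length_eq hk
  have hrow : ∀ i (hi : i < u.length), ∃ e < w.graph.numEdges, ℓ e = i + 1 ∧
      w.graph.InRow e u[i] := by
    intro i hi
    obtain ⟨e, he, hei, her⟩ := hrow₀ i hi
    exact ⟨e, he, (IsDepthLeftFirst.unique hk w hℓ₀ hℓ he).trans hei, her⟩
  -- An edge lying in a row leaves a node, so it is not the initial edge and its label is positive;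
  -- the word then records its row.
  have hout : ∀ e < w.graph.numEdges, ∀ r, w.graph.InRow e r →
      1 ≤ ℓ e ∧ u[ℓ e - 1]? = some r := by
    intro e he r her
    obtain ⟨v, hv, hev⟩ := inRow_mem_outs her
    have hnd : (0 :: w.graph.nodes.flatMap Node.outs).Nodup := closed_edges w ▸ List.nodup_range
    have h0 : ℓ 0 = 0 := hℓ.2.1 0 (by simp [ClosedComposition.graph, toGraph])
    have hne : ℓ e ≠ 0 := by
      intro hzero
      have he0 : e = 0 := hℓ.1.injOn he (show 0 < w.graph.numEdges by omega) (hzero.trans h0.symm)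
      exact (List.nodup_cons.1 hnd).1 (he0 ▸ Node.mem_outs_flatMap hv hev)
    have hlt : ℓ e < w.graph.numEdges := hℓ.1.mapsTo he
    obtain ⟨e', he', hei', her'⟩ := hrow (ℓ e - 1) (by omega)
    obtain rfl : e = e' := hℓ.1.injOn he he' (by omega)
    refine ⟨by omega, ?_⟩
    rw [List.getElem?_eq_getElem (by omega), inRow_unique w her her']
  intro a
  have hpos := Entry.pos a
  have hle := Entry.le hk a
  obtain ⟨e, he, hea, her⟩ := hrow ((a : ℕ) - 1) (by omega)
  have hget : u.getD ((a : ℕ) - 1) 0 = u[(a : ℕ) - 1]'(by omega) :=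
    List.getD_eq_getElem _ _ (by omega)
  refine ⟨e, u[(a : ℕ) - 1]'(by omega), he, by omega, her, ?_⟩
  simp only [IsBallot.toTableau, cellOfWord, hget]
  generalize u[(a : ℕ) - 1]'(by omega) = r
  congr 2
  rw [← card_filter_getElem?, ← Set.ncard_coe_finset]
  symm
  -- Edges of row `r` with smaller labels correspond to earlier occurrences of the letter `r`; the
  -- shift by one accounts for the label `0`.
  refine Set.ncard_congr (fun e' _ => ℓ e' - 1) ?_ ?_ ?_
  · rintro e' ⟨he', her', hlt⟩
    obtain ⟨h1, h2⟩ := hout e' he' r her'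
    simp only [Finset.coe_filter, Finset.mem_range, Set.mem_ofPred_eq]
    exact ⟨by omega, h2⟩
  · rintro x y ⟨hx, hxr, -⟩ ⟨hy, hyr, -⟩ hxy
    have h1 := (hout x hx r hxr).1
    have h2 := (hout y hy r hyr).1
    exact hℓ.1.injOn hx hy (by omega)
  · intro p hp
    simp only [Finset.coe_filter, Finset.mem_range, Set.mem_ofPred_eq] at hp
    obtain ⟨hp', hpr⟩ := List.getElem?_eq_some_iff.1 hp.2
    obtain ⟨e', he', hei', her'⟩ := hrow p hp'
    exact ⟨e', ⟨he', hpr ▸ her', by omega⟩, by omega⟩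

/-- A word that draws a given prograph. -/
noncomputable def word (hk : 2 ≤ k) (w : ClosedComposition k n) : List ℕ :=
  (exists_isWord hk w).choose

theorem isWord_word (hk : 2 ≤ k) (w : ClosedComposition k n) : IsWord w (word hk w) :=
  (exists_isWord hk w).choose_spec

theorem word_eq_iff (hk : 2 ≤ k) (w w' : ClosedComposition k n) :
    word hk w = word hk w' ↔ w.graph.Equivalent w'.graph := by
  constructor
  · intro h
    exact (isWord_word hk w).equivalent (h ▸ isWord_word hk w')
  · intro h
    exact ((isWord_word hk w).of_equivalent h).unique hk (isWord_word hk w')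

/-- Prographs correspond to ballot words. -/
noncomputable def wordEquiv (hk : 2 ≤ k) : ClosedPrograph k n ≃ {u : List ℕ // IsBallot k n u} :=
  Equiv.ofBijective
    (Quotient.lift (fun w => ⟨word hk w, (isWord_word hk w).isBallot⟩)
      fun w w' h => Subtype.ext ((word_eq_iff hk w w').2 h)) <| by
    constructor
    · rintro ⟨w⟩ ⟨w'⟩ h
      exact Quotient.sound ((word_eq_iff hk w w').1 (congrArg Subtype.val h))
    · rintro ⟨u, hu⟩
      obtain ⟨w, hw⟩ := hu.exists_isWord hk
      exact ⟨Quotient.mk _ w, Subtype.ext ((isWord_word hk w).unique hk hw)⟩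

/-- Ballot words correspond to tableaux. -/
noncomputable def tableauEquiv (hk : 2 ≤ k) :
    {u : List ℕ // IsBallot k n u} ≃ SetValuedSYT (rectDiagram 3 n) (density₃ k) :=
  Equiv.ofBijective (fun u => u.2.toTableau hk)
    ⟨fun u u' h => Subtype.ext (u.2.eq_of_toTableau_eq hk u'.2 h),
      fun T => ⟨⟨rowWord T, isBallot_rowWord T hk⟩, toTableau_rowWord T hk⟩⟩

/-! ### Counting the ballot words with three letters -/

/-- In every prefix of `u` there are at least as many letters `0` as `1`, and as many `1` as `2`. -/
def IsDominant (u : List ℕ) : Prop :=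
  ∀ i, (u.take i).count 1 ≤ (u.take i).count 0 ∧ (u.take i).count 2 ≤ (u.take i).count 1

theorem IsDominant.count_le {u : List ℕ} (h : IsDominant u) :
    u.count 1 ≤ u.count 0 ∧ u.count 2 ≤ u.count 1 := by
  simpa using h u.length

theorem isDominant_append_singleton (p : List ℕ) (x : ℕ) :
    IsDominant (p ++ [x]) ↔ IsDominant p ∧
      (p ++ [x]).count 1 ≤ (p ++ [x]).count 0 ∧ (p ++ [x]).count 2 ≤ (p ++ [x]).count 1 := by
  constructor
  · intro h
    refine ⟨fun i => ?_, h.count_le⟩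
    rcases le_total i p.length with hi | hi
    · simpa [List.take_append_of_le_length hi] using h i
    · simpa [List.take_of_length_le hi] using h p.length
  · rintro ⟨h, h'⟩ i
    rcases Nat.lt_or_ge p.length i with hi | hi
    · rwa [List.take_of_length_le (by simpa using hi)]
    · rw [List.take_append_of_le_length hi]
      exact h i

/-- The ballot words with `a` letters `0`, `b` letters `1` and `c` letters `2`. -/
def ballotSet (a b c : ℕ) : Set (List ℕ) :=
  {u | (∀ x ∈ u, x < 3) ∧ u.count 0 = a ∧ u.count 1 = b ∧ u.count 2 = c ∧ IsDominant u}

theorem isBallot_two_iff (u : List ℕ) : IsBallot 2 n u ↔ u ∈ ballotSet n n n := by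
  constructor
  · intro h
    have h0 := h.count 0 (by simp)
    have h1 := h.count 1 (by simp)
    have h2 := h.count 2 (by simp)
    simp only [density₃, Nat.reduceSub, one_mul] at h0 h1 h2
    exact ⟨h.lt_three, h0, h1, h2, fun i =>
      ⟨by simpa using h.count_one_le i, by simpa using h.count_two_le i⟩⟩
  · rintro ⟨h, h0, h1, h2, h3⟩
    refine ⟨h, fun r hr => ?_, fun i => by simpa using (h3 i).1, fun i => by simpa using (h3 i).2⟩
    interval_cases r <;> simp [density₃, h0, h1, h2]

/-- The strict inequalities say that the counts remain weakly decreasing once the last letter is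
removed; they also keep the subtractions from truncating. -/
theorem append_mem_ballotSet_iff {a b c : ℕ} (hb : b ≤ a) (hc : c ≤ b) (p : List ℕ) (x : ℕ) :
    p ++ [x] ∈ ballotSet a b c ↔
      (x = 0 ∧ b < a ∧ p ∈ ballotSet (a - 1) b c) ∨
      (x = 1 ∧ c < b ∧ p ∈ ballotSet a (b - 1) c) ∨
      (x = 2 ∧ 0 < c ∧ p ∈ ballotSet a b (c - 1)) := by
  simp only [ballotSet, Set.mem_ofPred_eq, isDominant_append_singleton, List.mem_append,
    List.mem_singleton, or_imp, forall_and, forall_eq, List.count_append]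
  rcases Nat.lt_or_ge x 3 with hx | hx
  · by_cases hd : IsDominant p
    · have := hd.count_le
      by_cases hl : ∀ x ∈ p, x < 3
      · interval_cases x <;> simp [hd, eq_true hl] <;> omega
      · simp only [hl, false_and, and_false, or_self]
    · simp only [hd, false_and, and_false, or_self]
  · constructor
    · rintro ⟨h, -⟩
      omega
    · rintro (h | h | h) <;> omega

theorem ballotSet_eq {a b c : ℕ} (hb : b ≤ a) (hc : c ≤ b) (ha : 0 < a) :
    ballotSet a b c =
      (if b < a then (· ++ [0]) '' ballotSet (a - 1) b c else ∅) ∪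
      ((if c < b then (· ++ [1]) '' ballotSet a (b - 1) c else ∅) ∪
      (if 0 < c then (· ++ [2]) '' ballotSet a b (c - 1) else ∅)) := by
  ext u
  rcases List.eq_nil_or_concat u with rfl | ⟨p, x, rfl⟩
  · have h1 : [] ∉ ballotSet a b c := fun h => by
      have := h.2.1
      simp at this
      omega
    simp only [h1, false_iff]
    split_ifs <;> simp
  · rw [List.concat_eq_append, append_mem_ballotSet_iff hb hc]
    split_ifs <;> simp [*] <;> grind

/-- The number of ballot words, by the hook length formula for three rows. -/
def ballotNumber (a b c : ℕ) : ℚ :=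
  (a + b + c).factorial * (a - b + 1) * (a - c + 2) * (b - c + 1) /
    ((a + 2).factorial * (b + 1).factorial * c.factorial)

/-- Over the common denominator each conditional term becomes a product with a factor `a - b`, `b -
c` or `c` that vanishes exactly when its condition fails. What remains is a polynomial identity. -/
theorem ballotNumber_eq {a b c : ℕ} (hb : b ≤ a) (hc : c ≤ b) (ha : 0 < a) :
    ballotNumber a b c = (if b < a then ballotNumber (a - 1) b c else 0) +
      ((if c < b then ballotNumber a (b - 1) c else 0) +
      (if 0 < c then ballotNumber a b (c - 1) else 0)) := by
  have hfac : ∀ m : ℕ, (m.factorial : ℚ) ≠ 0 := fun m => by exact_mod_cast m.factorial_ne_zero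
  have h0 : (if b < a then ballotNumber (a - 1) b c else 0) =
      (a + b + c - 1).factorial * (a + 2) * (a - b) * (a - c + 1) * (b - c + 1) /
        ((a + 2).factorial * (b + 1).factorial * c.factorial) := by
    split_ifs with h
    · obtain ⟨a, rfl⟩ : ∃ a', a = a' + 1 := ⟨a - 1, by omega⟩
      have e1 : a + 1 + b + c - 1 = a + b + c := by omega
      rw [ballotNumber, e1, Nat.add_sub_cancel, show a + 1 + 2 = a + 2 + 1 by rfl,
        Nat.factorial_succ (a + 2)]
      have := hfac (a + 2)
      have := hfac (b + 1)
      have := hfac c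
      push_cast
      field_simp
      ring
    · obtain rfl : a = b := by omega
      simp
  have h1 : (if c < b then ballotNumber a (b - 1) c else 0) =
      (a + b + c - 1).factorial * (b + 1) * (a - b + 2) * (a - c + 2) * (b - c) /
        ((a + 2).factorial * (b + 1).factorial * c.factorial) := by
    split_ifs with h
    · obtain ⟨b, rfl⟩ : ∃ b', b = b' + 1 := ⟨b - 1, by omega⟩
      have e1 : a + (b + 1) + c - 1 = a + b + c := by omega
      rw [ballotNumber, e1, Nat.add_sub_cancel, Nat.factorial_succ (b + 1)]
      have := hfac (a + 2)
      have := hfac (b + 1)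
      have := hfac c
      push_cast
      field_simp
      ring
    · obtain rfl : b = c := by omega
      simp
  have h2 : (if 0 < c then ballotNumber a b (c - 1) else 0) =
      (a + b + c - 1).factorial * c * (a - b + 1) * (a - c + 3) * (b - c + 2) /
        ((a + 2).factorial * (b + 1).factorial * c.factorial) := by
    split_ifs with h
    · obtain ⟨c, rfl⟩ : ∃ c', c = c' + 1 := ⟨c - 1, by omega⟩
      have e1 : a + b + (c + 1) - 1 = a + b + c := by omega
      rw [ballotNumber, e1, Nat.add_sub_cancel, Nat.factorial_succ c]
      have := hfac (a + 2)
      have := hfac (b + 1)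
      have := hfac c
      push_cast
      field_simp
      ring
    · obtain rfl : c = 0 := by omega
      simp
  have h3 : ((a + b + c).factorial : ℚ) = (a + b + c) * (a + b + c - 1).factorial := by
    rw [← Nat.mul_factorial_pred (by omega : a + b + c ≠ 0)]
    push_cast
    ring
  rw [h0, h1, h2, ballotNumber, h3]
  ring

theorem ballotSet_finite_and_ncard (m : ℕ) : ∀ a b c : ℕ, a + b + c = m → b ≤ a → c ≤ b →
    (ballotSet a b c).Finite ∧ ((ballotSet a b c).ncard : ℚ) = ballotNumber a b c := by
  induction m with
  | zero =>
    intro a b c h _ _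
    obtain ⟨rfl, rfl, rfl⟩ : a = 0 ∧ b = 0 ∧ c = 0 := by omega
    have : ballotSet 0 0 0 = {[]} := by
      ext u
      rw [Set.mem_singleton_iff]
      constructor
      · rintro ⟨h, h0, h1, h2, -⟩
        rw [← List.length_eq_zero_iff, length_eq_sum_count h, h0, h1, h2]
      · rintro rfl
        simp [ballotSet, IsDominant]
    rw [this]
    simp [ballotNumber]
  | succ m ih =>
    intro a b c h hb hc
    have ha : 0 < a := by omega
    have hinj : ∀ x : ℕ, Function.Injective (fun p : List ℕ => p ++ [x]) :=
      fun x => List.append_left_injective [x]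
    have key : ∀ (P : Prop) [Decidable P] (x : ℕ) (s : Set (List ℕ)) (q : ℚ),
        (P → s.Finite ∧ (s.ncard : ℚ) = q) →
        (if P then (· ++ [x]) '' s else ∅ : Set (List ℕ)).Finite ∧
        ((if P then (· ++ [x]) '' s else ∅ : Set (List ℕ)).ncard : ℚ) = if P then q else 0 := by
      intro P _ x s q hs
      split_ifs with hP
      · obtain ⟨h1, h2⟩ := hs hP
        exact ⟨h1.image _, by rw [Set.ncard_image_of_injective _ (hinj x), h2]⟩
      · simp
    have hdisj : ∀ (P Q : Prop) [Decidable P] [Decidable Q] (x y : ℕ) (s t : Set (List ℕ)),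
        x ≠ y → Disjoint (if P then (· ++ [x]) '' s else ∅ : Set (List ℕ))
          (if Q then (· ++ [y]) '' t else ∅) := by
      intro P Q _ _ x y s t hxy
      split_ifs <;> simp [Set.disjoint_left]
      exact fun p _ q _ _ h => hxy h.symm
    obtain ⟨f0, n0⟩ := key (b < a) 0 (ballotSet (a - 1) b c) _
      fun h => ih (a - 1) b c (by omega) (by omega) (by omega)
    obtain ⟨f1, n1⟩ := key (c < b) 1 (ballotSet a (b - 1) c) _
      fun h => ih a (b - 1) c (by omega) (by omega) (by omega)
    obtain ⟨f2, n2⟩ := key (0 < c) 2 (ballotSet a b (c - 1)) _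
      fun h => ih a b (c - 1) (by omega) (by omega) (by omega)
    rw [ballotSet_eq hb hc ha]
    refine ⟨f0.union (f1.union f2), ?_⟩
    rw [Set.ncard_union_eq (Set.disjoint_union_right.2 ⟨hdisj _ _ _ _ _ _ (by simp),
      hdisj _ _ _ _ _ _ (by simp)⟩) f0 (f1.union f2),
      Set.ncard_union_eq (hdisj _ _ _ _ _ _ (by simp)) f1 f2, Nat.cast_add, Nat.cast_add,
      n0, n1, n2, ← ballotNumber_eq hb hc ha]

/-- The three-dimensional Catalan numbers count the ballot words with three letters. -/
theorem card_ballot_two (n : ℕ) :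
    Nat.card {u : List ℕ // IsBallot 2 n u} *
      (n.factorial * (n + 1).factorial * (n + 2).factorial) = 2 * (3 * n).factorial := by
  have h := (ballotSet_finite_and_ncard (n + n + n) n n n rfl le_rfl le_rfl).2
  have hcard : Nat.card {u : List ℕ // IsBallot 2 n u} = (ballotSet n n n).ncard := by
    rw [← Nat.card_coe_set_eq]
    exact Nat.card_congr (Equiv.subtypeEquivRight isBallot_two_iff)
  rw [hcard]
  have h0 : (n.factorial : ℚ) ≠ 0 := by exact_mod_cast n.factorial_ne_zero
  have h1 : ((n + 1).factorial : ℚ) ≠ 0 := by exact_mod_cast (n + 1).factorial_ne_zero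
  have h2 : ((n + 2).factorial : ℚ) ≠ 0 := by exact_mod_cast (n + 2).factorial_ne_zero
  have h3 : 3 * n = n + n + n := by ring
  rw [← Nat.cast_inj (R := ℚ)]
  push_cast
  -- At equal arguments the three difference factors are `1`, `2` and `1`, whence the factor `2`.
  rw [h, h3, ballotNumber]
  field_simp
  ring

end Prograph

theorem mainTheorem1 (n k : ℕ) (hn : 1 ≤ n) (hk : 2 ≤ k) :
    (∀ w : Prograph.ClosedComposition k n, ∃ ℓ : ℕ → ℕ, w.graph.IsDepthLeftFirst ℓ ∧
      ∀ ℓ' : ℕ → ℕ, w.graph.IsDepthLeftFirst ℓ' → Set.EqOn ℓ' ℓ (Set.Iio w.graph.numEdges)) ∧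
    (∃ Φ : Prograph.ClosedPrograph k n → SetValuedSYT (rectDiagram 3 n) (density₃ k),
      Function.Bijective Φ ∧
      ∀ (w : Prograph.ClosedComposition k n) (ℓ : ℕ → ℕ), w.graph.IsDepthLeftFirst ℓ →
        Prograph.IsTableauOf (Φ (Quotient.mk (Prograph.closedSetoid k n) w)) w.graph ℓ) ∧
    Nat.card (Prograph.ClosedPrograph k n) = Nat.card (SetValuedSYT (rectDiagram 3 n) (density₃ k)) ∧
    (k = 2 → Nat.card (Prograph.ClosedPrograph k n) *
      (n.factorial * (n + 1).factorial * (n + 2).factorial) = 2 * (3 * n).factorial) := by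
  let Φ : Prograph.ClosedPrograph k n ≃ SetValuedSYT (rectDiagram 3 n) (density₃ k) :=
    (Prograph.wordEquiv hk).trans (Prograph.tableauEquiv hk)
  refine ⟨fun w => ?_, ⟨Φ, Φ.bijective, fun w ℓ hℓ => ?_⟩, Nat.card_congr Φ, ?_⟩
  · obtain ⟨ℓ, hℓ, -⟩ := (Prograph.isWord_word hk w).exists_labelling hk
    exact ⟨ℓ, hℓ, fun ℓ' hℓ' => Prograph.IsDepthLeftFirst.unique hk w hℓ hℓ'⟩
  -- By definition `Φ` sends the class of `w` to the tableau of `word hk w`.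
  · exact (Prograph.isWord_word hk w).isTableauOf hk hℓ
  · rintro rfl
    rw [Nat.card_congr (Prograph.wordEquiv hk)]
    exact Prograph.card_ballot_two n
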